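/- Let $L_{\mathrm{res},\iota}$ be the three-sorted first-order language with sorts for a field $K$, a residue field $k$ (both with the ring symbols $0,1,+,-,\cdot$) and a value group with infinity $\Gamma\cup\{\infty\}$ (with $0,+,\leq,\infty$), and with function symbols $v:K\to\Gamma\cup\{\infty\}$, $\pi:K\to k$, $\iota:k\to K$ and $\mathrm{res}:K\to k$. Let $\mathrm{VF}_{\mathrm{res},\iota}$ be the $L_{\mathrm{res},\iota}$-theory axiomatized by the following statements. 1. $(K,v)$ is a valued field (possibly trivially valued) with value group $\Gamma$ (an ordered abelian group, $v$ being surjective onto $\Gamma\cup\{\infty\}$) and valuation ring $\mathcal O_K=\{a\in K: v(a)\geq 0\}$; the restriction of $\pi$ to $\mathcal O_K$ is the residue map $\mathcal O_K\to k$, i.e. a surjective ring homomorphism onto the field $k$ whose kernel is the maximal ideal of $\mathcal O_K$ (and, by convention, $\pi(a)=0$ for $a\notin\mathcal O_K$); $K$ and $k$ have the same characteristic; and $\iota:k\to K$ is a field embedding with image in $\mathcal O_K$ such that $\pi\circ\iota=\mathrm{id}_k$. 2. $\mathrm{res}(a)=\pi(a)$ for all $a\in\mathcal O_K$. 3. $\mathrm{res}$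 is $k$-linear: $\mathrm{res}(\iota(\lambda)a+\iota(\mu)b)=\lambda\,\mathrm{res}(a)+\mu\,\mathrm{res}(b)$ for all $\lambda,\mu\in k$ and $a,b\in K$. A theory $T^*$ is a model companion of a theory $T$ in the same language if every model of $T$ embeds into a model of $T^*$, every model of $T^*$ embeds into a model of $T$, and $T^*$ is model-complete, i.e. every embedding between models of $T^*$ is elementary. Theorem. The theory $\mathrm{VF}_{\mathrm{res},\iota}$ does not admit a model companion. -/

import Mathlib

universe u

/-! ### Many-sorted first-order logic -/

/-- A many-sorted first-order language: a function symbol `f` takes arguments of the sorts listed in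
`dom f` to the sort `cod f`; a relation symbol `R` takes arguments of the sorts listed in
`arity R`. -/
structure MSLanguage where
  Sorts : Type
  Func : Type
  dom : Func → List Sorts
  cod : Func → Sorts
  Rel : Type
  arity : Rel → List Sorts

namespace MSLanguage

/-- `Var l s` is the type of the positions at which the sort `s` occurs in the list `l`. These are
the variables of sort `s` in the context `l`; quantifiers push a new variable in front. -/
inductive Var {S : Type} : List S → S → Type
  | zero {l : List S} {s : S} : Var (s :: l) s
  | succ {l : List S} {s t : S} : Var l s → Var (t :: l) s

/-- Tuples with one entry of the appropriate sort for each position of the list `l`. -/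
abbrev Env {S : Type} (M : S → Type u) (l : List S) : Type u :=
  ∀ s, Var l s → M s

/-- The empty tuple. -/
def Env.nil {S : Type} {M : S → Type u} : Env M []
  | _, x => nomatch x

/-- Put an entry in front of a tuple. -/
def Env.cons {S : Type} {M : S → Type u} {s : S} {l : List S} (a : M s) (ρ : Env M l) :
    Env M (s :: l)
  | _, .zero => a
  | _, .succ x => ρ _ x

/-- Terms of a given sort, with variables in the context `l`. -/
inductive Term (L : MSLanguage) (l : List L.Sorts) : L.Sorts → Type
  | var {s : L.Sorts} (x : Var l s) : Term L l s
  | app (f : L.Func) (ts : ∀ s, Var (L.dom f) s → Term L l s) : Term L l (L.cod f)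

/-- First-order formulas with free variables in the context `l`. -/
inductive Formula (L : MSLanguage) : List L.Sorts → Type
  | falsum {l : List L.Sorts} : Formula L l
  | equal {l : List L.Sorts} {s : L.Sorts} (t₁ t₂ : Term L l s) : Formula L l
  | rel {l : List L.Sorts} (R : L.Rel) (ts : ∀ s, Var (L.arity R) s → Term L l s) : Formula L l
  | imp {l : List L.Sorts} (φ ψ : Formula L l) : Formula L l
  | all {l : List L.Sorts} (s : L.Sorts) (φ : Formula L (s :: l)) : Formula L l

namespace Formula

variable {L : MSLanguage} {l : List L.Sorts}

/-- Negation. -/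
def not (φ : Formula L l) : Formula L l := φ.imp falsum

/-- Disjunction. -/
def or (φ ψ : Formula L l) : Formula L l := φ.not.imp ψ

/-- Conjunction. -/
def and (φ ψ : Formula L l) : Formula L l := (φ.imp ψ.not).not

/-- Equivalence. -/
def iff (φ ψ : Formula L l) : Formula L l := (φ.imp ψ).and (ψ.imp φ)

/-- Existential quantification over the sort `s`. -/
def ex (s : L.Sorts) (φ : Formula L (s :: l)) : Formula L l := (all s φ.not).not

end Formula

/-- Sentences: formulas without free variables. -/
abbrev Sentence (L : MSLanguage) : Type := Formula L []

/-- Theories: sets of sentences. -/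
abbrev Theory (L : MSLanguage) : Type := Set (Sentence L)

/-- Structures of a many-sorted language. -/
structure Structure (L : MSLanguage) where
  carrier : L.Sorts → Type u
  funMap : ∀ f : L.Func, Env carrier (L.dom f) → carrier (L.cod f)
  relMap : ∀ R : L.Rel, Env carrier (L.arity R) → Prop

variable {L : MSLanguage}

/-- The value of a term under an assignment. -/
def Term.realize (M : Structure.{u} L) {l : List L.Sorts} (ρ : Env M.carrier l) :
    ∀ {s : L.Sorts}, Term L l s → M.carrier s
  | _, .var x => ρ _ x
  | _, .app f ts => M.funMap f fun s i => (ts s i).realize M ρ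

/-- Tarski satisfaction of a formula under an assignment. -/
def Formula.Realize (M : Structure.{u} L) :
    ∀ {l : List L.Sorts}, Formula L l → Env M.carrier l → Prop
  | _, .falsum, _ => False
  | _, .equal t₁ t₂, ρ => t₁.realize M ρ = t₂.realize M ρ
  | _, .rel R ts, ρ => M.relMap R fun s i => (ts s i).realize M ρ
  | _, .imp φ ψ, ρ => φ.Realize M ρ → ψ.Realize M ρ
  | _, .all s φ, ρ => ∀ a : M.carrier s, φ.Realize M (Env.cons a ρ)

/-- `M` is a model of the theory `T`. -/
def Structure.Models (M : Structure.{u} L) (T : Theory L) : Prop :=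
  ∀ φ ∈ T, Formula.Realize M φ Env.nil

/-- Embeddings of structures: sortwise injective maps that commute with the function symbols, and
preserve and reflect the relation symbols. -/
structure Embedding (M N : Structure.{u} L) where
  toFun : ∀ s, M.carrier s → N.carrier s
  injective : ∀ s, Function.Injective (toFun s)
  map_fun : ∀ (f : L.Func) (xs : Env M.carrier (L.dom f)),
    toFun _ (M.funMap f xs) = N.funMap f fun s i => toFun s (xs s i)
  map_rel : ∀ (R : L.Rel) (xs : Env M.carrier (L.arity R)),
    M.relMap R xs ↔ N.relMap R fun s i => toFun s (xs s i)

/-- An embedding is elementary if it preserves and reflects the truth of all formulas. -/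
def Embedding.IsElementary {M N : Structure.{u} L} (e : Embedding M N) : Prop :=
  ∀ (l : List L.Sorts) (φ : Formula L l) (ρ : Env M.carrier l),
    φ.Realize M ρ ↔ φ.Realize N fun s x => e.toFun s (ρ s x)

/-- A theory is model-complete if all embeddings between its models are elementary. -/
def Theory.IsModelComplete (T : Theory L) : Prop :=
  ∀ M N : Structure.{u} L, M.Models T → N.Models T → ∀ e : Embedding M N, e.IsElementary

/-- `T'` is a model companion of `T`. -/
structure Theory.IsModelCompanion (T T' : Theory L) : Prop where
  embeds_left : ∀ M : Structure.{u} L, M.Models T →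
    ∃ N : Structure.{u} L, N.Models T' ∧ Nonempty (Embedding M N)
  embeds_right : ∀ M : Structure.{u} L, M.Models T' →
    ∃ N : Structure.{u} L, N.Models T ∧ Nonempty (Embedding M N)
  modelComplete : Theory.IsModelComplete.{u} T'

end MSLanguage

/-! ### The three-sorted language of valued fields with a lift and a total residue map -/

namespace ResidueForm

open MSLanguage

/-- The three sorts: the field `K`, the value group with infinity `Γ ∪ {∞}`, and the residue
field `k`. -/
inductive VSort
  | field
  | value
  | residue

/-- The function symbols. -/
inductive VFunc
  | fieldZero | fieldOne | fieldNeg | fieldAdd | fieldMul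
  | residueZero | residueOne | residueNeg | residueAdd | residueMul
  | valueZero | valueTop | valueAdd
  /-- the valuation `v : K → Γ ∪ {∞}` -/
  | val
  /-- the residue map `π`, extended by `0` outside the valuation ring -/
  | proj
  /-- the lift `ι : k → K` -/
  | lift
  /-- the total residue map `res : K → k` -/
  | res

/-- The only relation symbol is the order `≤` of `Γ ∪ {∞}`. -/
inductive VRel
  | valueLE

/-- The sorts of the arguments of the function symbols. -/
def VFunc.dom : VFunc → List VSort
  | fieldZero | fieldOne => []
  | fieldNeg => [.field]
  | fieldAdd | fieldMul => [.field, .field]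
  | residueZero | residueOne => []
  | residueNeg => [.residue]
  | residueAdd | residueMul => [.residue, .residue]
  | valueZero | valueTop => []
  | valueAdd => [.value, .value]
  | val => [.field]
  | proj => [.field]
  | lift => [.residue]
  | res => [.field]

/-- The sorts of the values of the function symbols. -/
def VFunc.cod : VFunc → VSort
  | fieldZero | fieldOne | fieldNeg | fieldAdd | fieldMul => .field
  | residueZero | residueOne | residueNeg | residueAdd | residueMul => .residue
  | valueZero | valueTop | valueAdd => .value
  | val => .value
  | proj => .residue
  | lift => .field
  | res => .residue

/-- The language of valued fields with a lift of the residue field and a total residue map. -/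
abbrev Lres : MSLanguage where
  Sorts := VSort
  Func := VFunc
  dom := VFunc.dom
  cod := VFunc.cod
  Rel := VRel
  arity := fun _ => [.value, .value]

/-- Terms of the language. -/
abbrev T (l : List VSort) (s : VSort) : Type := Term Lres l s

/-- Formulas of the language. -/
abbrev F (l : List VSort) : Type := Formula Lres l

section Terms

variable {l : List VSort} {s₀ s₁ s₂ s₃ : VSort}

/-- The variable bound by the innermost quantifier. -/
def x0 : T (s₀ :: l) s₀ := .var .zero

/-- The variable bound by the second innermost quantifier. -/
def x1 : T (s₀ :: s₁ :: l) s₁ := .var (.succ .zero)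

/-- The variable bound by the third innermost quantifier. -/
def x2 : T (s₀ :: s₁ :: s₂ :: l) s₂ := .var (.succ (.succ .zero))

/-- The variable bound by the fourth innermost quantifier. -/
def x3 : T (s₀ :: s₁ :: s₂ :: s₃ :: l) s₃ := .var (.succ (.succ (.succ .zero)))

instance : Zero (T l .field) := ⟨.app (L := Lres) .fieldZero Env.nil⟩
instance : One (T l .field) := ⟨.app (L := Lres) .fieldOne Env.nil⟩
instance : Neg (T l .field) := ⟨fun a => .app (L := Lres) .fieldNeg (Env.cons a Env.nil)⟩
instance : Add (T l .field) :=
  ⟨fun a b => .app (L := Lres) .fieldAdd (Env.cons a (Env.cons b Env.nil))⟩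
instance : Mul (T l .field) :=
  ⟨fun a b => .app (L := Lres) .fieldMul (Env.cons a (Env.cons b Env.nil))⟩

instance : Zero (T l .residue) := ⟨.app (L := Lres) .residueZero Env.nil⟩
instance : One (T l .residue) := ⟨.app (L := Lres) .residueOne Env.nil⟩
instance : Neg (T l .residue) := ⟨fun a => .app (L := Lres) .residueNeg (Env.cons a Env.nil)⟩
instance : Add (T l .residue) :=
  ⟨fun a b => .app (L := Lres) .residueAdd (Env.cons a (Env.cons b Env.nil))⟩
instance : Mul (T l .residue) :=
  ⟨fun a b => .app (L := Lres) .residueMul (Env.cons a (Env.cons b Env.nil))⟩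

instance : Zero (T l .value) := ⟨.app (L := Lres) .valueZero Env.nil⟩
instance : Top (T l .value) := ⟨.app (L := Lres) .valueTop Env.nil⟩
instance : Add (T l .value) :=
  ⟨fun a b => .app (L := Lres) .valueAdd (Env.cons a (Env.cons b Env.nil))⟩

/-- The term `v(a)`. -/
def val (a : T l .field) : T l .value := .app (L := Lres) .val (Env.cons a Env.nil)

/-- The term `π(a)`. -/
def proj (a : T l .field) : T l .residue := .app (L := Lres) .proj (Env.cons a Env.nil)

/-- The term `ι(α)`. -/
def lift (α : T l .residue) : T l .field := .app (L := Lres) .lift (Env.cons α Env.nil)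

/-- The term `res(a)`. -/
def res (a : T l .field) : T l .residue := .app (L := Lres) .res (Env.cons a Env.nil)

/-- The formula `γ ≤ δ`. -/
def le (γ δ : T l .value) : F l := .rel (L := Lres) .valueLE (Env.cons γ (Env.cons δ Env.nil))

/-- The formula `a ∈ 𝒪_K`, that is, `0 ≤ v(a)`. -/
def integral (a : T l .field) : F l := le 0 (val a)

/-- The term `1 + ⋯ + 1` with `n` summands. -/
def numeral {s : VSort} [Zero (T l s)] [One (T l s)] [Add (T l s)] : ℕ → T l s
  | 0 => 0
  | n + 1 => numeral n + 1

/-- Quantification over the field. -/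
abbrev allK (φ : F (.field :: l)) : F l := .all (L := Lres) .field φ

/-- Quantification over the values. -/
abbrev allV (φ : F (.value :: l)) : F l := .all (L := Lres) .value φ

/-- Quantification over the residue field. -/
abbrev allR (φ : F (.residue :: l)) : F l := .all (L := Lres) .residue φ

/-- Existential quantification over the field. -/
abbrev exK (φ : F (.field :: l)) : F l := .ex (L := Lres) .field φ

/-- Existential quantification over the values. -/
abbrev exV (φ : F (.value :: l)) : F l := .ex (L := Lres) .value φ

end Terms

open Formula in
/-- The axioms of fields, for one of the sorts. -/
def fieldAxioms (s : VSort) [∀ l, Zero (T l s)] [∀ l, One (T l s)] [∀ l, Neg (T l s)]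
    [∀ l, Add (T l s)] [∀ l, Mul (T l s)] : Theory Lres :=
  { all s <| all s <| all s <| equal (x2 + x1 + x0) (x2 + (x1 + x0)),
    all s <| all s <| equal (x1 + x0) (x0 + x1),
    all s <| equal (0 + x0) x0,
    all s <| equal (-x0 + x0) 0,
    all s <| all s <| all s <| equal (x2 * x1 * x0) (x2 * (x1 * x0)),
    all s <| all s <| equal (x1 * x0) (x0 * x1),
    all s <| equal (1 * x0) x0,
    all s <| all s <| all s <| equal (x2 * (x1 + x0)) (x2 * x1 + x2 * x0),
    not (equal (0 : T [] s) 1),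
    all s <| or (equal x0 0) (ex s (equal (x1 * x0) 1)) }

open Formula in
/-- The sort of values is `Γ ∪ {∞}` for an ordered abelian group `Γ`. -/
def valueAxioms : Theory Lres :=
  { allV <| le x0 x0,
    allV <| allV <| allV <| imp (le x2 x1) (imp (le x1 x0) (le x2 x0)),
    allV <| allV <| imp (le x1 x0) (imp (le x0 x1) (equal x1 x0)),
    allV <| allV <| or (le x1 x0) (le x0 x1),
    allV <| le x0 ⊤,
    allV <| allV <| allV <| equal (x2 + x1 + x0) (x2 + (x1 + x0)),
    allV <| allV <| equal (x1 + x0) (x0 + x1),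
    allV <| equal (0 + x0) x0,
    allV <| equal (⊤ + x0) ⊤,
    not (equal (0 : T [] .value) ⊤),
    allV <| or (equal x0 ⊤) (exV (equal (x1 + x0) 0)),
    allV <| allV <| allV <| imp (le x2 x1) (le (x2 + x0) (x1 + x0)) }

open Formula in
/-- `v` is a valuation of `K` with value group `Γ`. -/
def valuationAxioms : Theory Lres :=
  { allK <| iff (equal (val x0) ⊤) (equal x0 0),
    allK <| allK <| equal (val (x1 * x0)) (val x1 + val x0),
    allK <| allK <| or (le (val x1) (val (x1 + x0))) (le (val x0) (val (x1 + x0))),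
    allV <| exK <| equal (val x0) x1 }

open Formula in
/-- `π`, restricted to the valuation ring, is a surjective ring homomorphism onto `k` whose kernel
is the maximal ideal; outside the valuation ring it has the conventional value `0`. -/
def projAxioms : Theory Lres :=
  { allK <| allK <| imp (integral x1) (imp (integral x0)
      (equal (proj (x1 + x0)) (proj x1 + proj x0))),
    allK <| allK <| imp (integral x1) (imp (integral x0)
      (equal (proj (x1 * x0)) (proj x1 * proj x0))),
    equal (proj 1) (1 : T [] .residue),
    allK <| imp (integral x0) (iff (equal (proj x0) 0) (not (equal (val x0) 0))),
    allR <| exK <| and (integral x0) (equal (proj x0) x1),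
    allK <| imp (not (integral x0)) (equal (proj x0) 0) }

open Formula in
/-- `K` and `k` have the same characteristic. -/
def equalCharAxioms : Theory Lres :=
  Set.range fun n : ℕ =>
    iff (equal (numeral n : T [] .field) 0) (equal (numeral n : T [] .residue) 0)

open Formula in
/-- `ι : k → K` is a field embedding with values in the valuation ring and `π ∘ ι = id`. -/
def liftAxioms : Theory Lres :=
  { allR <| allR <| equal (lift (x1 + x0)) (lift x1 + lift x0),
    allR <| allR <| equal (lift (x1 * x0)) (lift x1 * lift x0),
    equal (lift 1) (1 : T [] .field),
    allR <| integral (lift x0),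
    allR <| equal (proj (lift x0)) x0 }

open Formula in
/-- `res` restricts to `π` on the valuation ring, and `res (λ a + μ b) = λ res a + μ res b` for
`λ, μ ∈ k` and `a, b ∈ K`, where `k` acts on `K` through `ι`. -/
def resAxioms : Theory Lres :=
  { allK <| imp (integral x0) (equal (res x0) (proj x0)),
    allR <| allR <| allK <| allK <|
      equal (res (lift x3 * x1 + lift x2 * x0)) (x3 * res x1 + x2 * res x0) }

/-- The theory of equal characteristic valued fields with a lift `ι` of the residue field and a
total residue map `res`. -/
def VFresLift : Theory Lres :=
  fieldAxioms .field ∪ fieldAxioms .residue ∪ valueAxioms ∪ valuationAxioms ∪ projAxioms ∪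
    equalCharAxioms ∪ liftAxioms ∪ resAxioms

end ResidueForm

/-! Let `a` lie in the maximal ideal and let `b` be arbitrary. The universal formula `resVanishes`
says that `res` kills every `b / (y - a)` with `y` a nonzero element of the residue field `k`; the
division is multiplied out, since the language has no inverse. Whether this can be broken in an
extension depends on whether some `b * a ^ n` is integral, and that is not preserved by ultrapowers.

If `b * a ^ n` is integral for some `n`, the geometric expansion `b / (y - a) = ∑ i < n, b * a ^ i /
y ^ (i + 1) + (b * a ^ n) / (y ^ n * (y - a))` has an integral last term. Hence if `res` kills all
`b * a ^ i`, it also kills `b / (y - a)`, in every extension (`res_div_eq_zero`).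

If no `b * a ^ n` is integral, the elements `b / (y - a)` for distinct nonzero `y` are linearly
independent over `k` modulo the valuation ring (`linearIndependent_div`). When `k` is infinite, a
suitable ultrapower then contains such an element outside a subspace that includes the valuation
ring and the original field, so `res` can be changed there to take the value `1` at it
(`exists_extension`).

Now let `T` be a model companion and embed the Laurent series over `ℚ`, with `res` the constant
coefficient, into a model `N` of `T`. For `a = t ^ 2` and `b = t ^ (-(2 * m + 1))` all `b * a ^ n`
have odd exponents, so the first case gives `resVanishes` in `N` for every `m`
(`resVanishes_of_laurent`). By Łoś it holds in an ultrapower of `N` for the class of these `b`,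
where no `b * a ^ n` is integral. The second case gives an extension in which the formula fails,
hence a further model of `T` in which it fails, against model-completeness. -/

namespace MSLanguage

variable {L : MSLanguage}

/-! ### Tuples and embeddings in many-sorted logic -/

/-- A context is a finite list, so only finitely many members of the filter are intersected. -/
theorem Var.eventually_forall {S ι : Type} {U : Filter ι} {l : List S}
    {p : ∀ s, Var l s → ι → Prop} (h : ∀ s x, ∀ᶠ n in U, p s x n) :
    ∀ᶠ n in U, ∀ s x, p s x n := by
  induction l with
  | nil => exact Filter.Eventually.of_forall fun n s x => nomatch x
  | cons t l ih =>
    filter_upwards [h t .zero, ih fun s x => h s (.succ x)] with n h₀ h₁ s x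
    cases x with
    | zero => exact h₀
    | succ x => exact h₁ s x

theorem Env.nil_eq {S : Type} {M : S → Type u} (ρ : Env M []) : ρ = Env.nil := by
  funext t x
  cases x

namespace Embedding

/-- The composition of embeddings. -/
def comp {M N P : Structure.{u} L} (g : Embedding N P) (f : Embedding M N) : Embedding M P where
  toFun s x := g.toFun s (f.toFun s x)
  injective s := (g.injective s).comp (f.injective s)
  map_fun F xs := by rw [f.map_fun, g.map_fun]
  map_rel R xs := by rw [f.map_rel, g.map_rel]

theorem realize_term {M N : Structure.{u} L} (e : Embedding M N) {l : List L.Sorts}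
    (ρ : Env M.carrier l) {s : L.Sorts} (t : Term L l s) :
    t.realize N (fun s x => e.toFun s (ρ s x)) = e.toFun s (t.realize M ρ) := by
  induction t with
  | var x => rfl
  | app f ts ih => simp only [Term.realize, ih, e.map_fun]

end Embedding

/-! ### Ultrapowers -/

section Ultrapower

variable (U : Ultrafilter ℕ) (M : Structure.{u} L)

/-- The ultrapower of a structure. -/
noncomputable def Structure.ultrapower : Structure.{u} L where
  carrier s := (U : Filter ℕ).Germ (M.carrier s)
  funMap f xs := ((fun n => M.funMap f fun s i => (xs s i).out n :) : ℕ → M.carrier (L.cod f))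
  relMap R xs := ∀ᶠ n in (U : Filter ℕ), M.relMap R fun s i => (xs s i).out n

variable {M}

/-- The class of a sequence in the ultrapower. -/
def Structure.ultrapower.mk {s : L.Sorts} (x : ℕ → M.carrier s) : (M.ultrapower U).carrier s :=
  ((x : ℕ → M.carrier s) : (U : Filter ℕ).Germ (M.carrier s))

open Structure

variable {U}

theorem ultrapower.mk_surjective {s : L.Sorts} (x : (M.ultrapower U).carrier s) :
    ∃ f : ℕ → M.carrier s, ultrapower.mk U f = x :=
  Quotient.exists_rep x

theorem ultrapower.mk_eq {s : L.Sorts} {x y : ℕ → M.carrier s} :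
    ultrapower.mk U x = ultrapower.mk U y ↔ ∀ᶠ n in (U : Filter ℕ), x n = y n :=
  Filter.Germ.coe_eq

/-- The operations of the ultrapower are computed from chosen representatives. These agree almost
everywhere with any given representatives, for all arguments of a symbol at once, so the choice does
not matter. -/
theorem ultrapower.out_mk {l : List L.Sorts} (x : ∀ s, Var l s → ℕ → M.carrier s) :
    ∀ᶠ n in (U : Filter ℕ), (fun s i => Quotient.out (ultrapower.mk U (x s i)) n) =
      fun s i => x s i n := by
  have : ∀ s i, ∀ᶠ n in (U : Filter ℕ),
      Quotient.out (ultrapower.mk U (x s i)) n = x s i n := fun s i =>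
    Quotient.exact (Quotient.out_eq (ultrapower.mk U (x s i)))
  filter_upwards [Var.eventually_forall this] with n hn
  funext s i
  exact hn s i

theorem ultrapower.funMap_mk (f : L.Func) (x : ∀ s, Var (L.dom f) s → ℕ → M.carrier s) :
    (M.ultrapower U).funMap f (fun s i => ultrapower.mk U (x s i)) =
      ultrapower.mk U fun n => M.funMap f fun s i => x s i n := by
  refine ultrapower.mk_eq.2 ?_
  filter_upwards [ultrapower.out_mk x] with n hn
  exact congrArg _ hn

theorem ultrapower.relMap_mk (R : L.Rel) (x : ∀ s, Var (L.arity R) s → ℕ → M.carrier s) :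
    (M.ultrapower U).relMap R (fun s i => ultrapower.mk U (x s i)) ↔
      ∀ᶠ n in (U : Filter ℕ), M.relMap R fun s i => x s i n := by
  refine Filter.eventually_congr ?_
  filter_upwards [ultrapower.out_mk x] with n hn
  exact iff_of_eq (congrArg _ hn)

theorem ultrapower.realize_term {l : List L.Sorts} (ρ : ∀ s, Var l s → ℕ → M.carrier s)
    {s : L.Sorts} (t : Term L l s) :
    t.realize (M.ultrapower U) (fun s i => ultrapower.mk U (ρ s i)) =
      ultrapower.mk U fun n => t.realize M fun s i => ρ s i n := by
  induction t with
  | var x => rfl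
  | app f ts ih => simp only [Term.realize, ih, ultrapower.funMap_mk]

theorem ultrapower.cons_mk {l : List L.Sorts} {s : L.Sorts} (a : ℕ → M.carrier s)
    (ρ : ∀ s, Var l s → ℕ → M.carrier s) :
    (fun t x => ultrapower.mk U (Env.cons (M := fun s => ℕ → M.carrier s) a ρ t x)) =
      Env.cons (M := (M.ultrapower U).carrier) (ultrapower.mk U a)
        (fun t x => ultrapower.mk U (ρ t x)) := by
  funext t x
  cases x <;> rfl

theorem ultrapower.cons_apply {l : List L.Sorts} {s : L.Sorts} (a : ℕ → M.carrier s)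
    (ρ : ∀ s, Var l s → ℕ → M.carrier s) (n : ℕ) :
    (fun t x => Env.cons (M := fun s => ℕ → M.carrier s) a ρ t x n) =
      Env.cons (M := M.carrier) (a n) (fun t x => ρ t x n) := by
  funext t x
  cases x <;> rfl

/-- The theorem of Łoś for ultrapowers. -/
theorem ultrapower.realize_formula {l : List L.Sorts} (φ : Formula L l)
    (ρ : ∀ s, Var l s → ℕ → M.carrier s) :
    φ.Realize (M.ultrapower U) (fun s i => ultrapower.mk U (ρ s i)) ↔
      ∀ᶠ n in (U : Filter ℕ), φ.Realize M fun s i => ρ s i n := by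
  induction φ with
  | falsum => simp [Formula.Realize, U.neBot.ne]
  | equal t₁ t₂ => simp only [Formula.Realize, ultrapower.realize_term, ultrapower.mk_eq]
  | rel R ts => simp only [Formula.Realize, ultrapower.realize_term, ultrapower.relMap_mk]
  | imp φ ψ ih₁ ih₂ => simp only [Formula.Realize, ih₁, ih₂, Ultrafilter.eventually_imp]
  | all s φ ih =>
    simp only [Formula.Realize]
    constructor
    · intro h
      by_contra hc
      rw [← Ultrafilter.eventually_not] at hc
      simp only [not_forall] at hc
      -- Sorts may be empty in general. Here a counterexample at one index supplies the default
      -- value needed to assemble counterexamples into a sequence.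
      have hne : Nonempty (M.carrier s) := by
        obtain ⟨n, a, -⟩ := hc.exists
        exact ⟨a⟩
      obtain ⟨a, ha⟩ := hc.choice
      have h1 := h (ultrapower.mk U a)
      rw [← ultrapower.cons_mk, ih] at h1
      obtain ⟨n, hn, hn'⟩ := (h1.and ha).exists
      rw [ultrapower.cons_apply] at hn
      exact hn' hn
    · intro h a
      obtain ⟨a, rfl⟩ := ultrapower.mk_surjective a
      rw [← ultrapower.cons_mk, ih]
      filter_upwards [h] with n hn
      rw [ultrapower.cons_apply]
      exact hn (a n)

theorem Structure.Models.ultrapower {T : Theory L} (h : M.Models T) :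
    (M.ultrapower U).Models T := by
  intro φ hφ
  have := ultrapower.realize_formula (U := U) φ (fun s (i : Var [] s) => nomatch i) (M := M)
  rw [Env.nil_eq (M := (M.ultrapower U).carrier) fun s i => _] at this
  refine this.2 (Filter.Eventually.of_forall fun n => ?_)
  rw [Env.nil_eq (M := M.carrier) fun s i => _]
  exact h φ hφ

variable (U M) in
/-- The diagonal embedding into the ultrapower. -/
def Structure.diagonal : Embedding M (M.ultrapower U) where
  toFun _ x := ultrapower.mk U fun _ => x
  injective _ _ _ h := (ultrapower.mk_eq.1 h).exists.choose_spec
  map_fun f xs := (ultrapower.funMap_mk f fun s i _ => xs s i).symm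
  map_rel R xs := by
    rw [ultrapower.relMap_mk R fun s i _ => xs s i]
    simp

end Ultrapower

end MSLanguage

/-! ### Operations of a structure and evaluation of terms -/

namespace ResidueForm

open MSLanguage

section Operations

variable (M : Structure.{u} Lres)

/-- The field sort of a structure. -/
abbrev FieldSort : Type u := M.carrier VSort.field

/-- The sort of values of a structure. -/
abbrev ValueSort : Type u := M.carrier VSort.value

/-- The residue sort of a structure. -/
abbrev ResidueSort : Type u := M.carrier VSort.residue

variable {M}

instance : Zero (FieldSort M) := ⟨M.funMap VFunc.fieldZero Env.nil⟩
instance : One (FieldSort M) := ⟨M.funMap VFunc.fieldOne Env.nil⟩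
instance : Neg (FieldSort M) := ⟨fun a => M.funMap VFunc.fieldNeg (Env.cons a Env.nil)⟩
instance : Add (FieldSort M) :=
  ⟨fun a b => M.funMap VFunc.fieldAdd (Env.cons a (Env.cons b Env.nil))⟩
instance : Mul (FieldSort M) :=
  ⟨fun a b => M.funMap VFunc.fieldMul (Env.cons a (Env.cons b Env.nil))⟩

instance : Zero (ResidueSort M) := ⟨M.funMap VFunc.residueZero Env.nil⟩
instance : One (ResidueSort M) := ⟨M.funMap VFunc.residueOne Env.nil⟩
instance : Neg (ResidueSort M) := ⟨fun a => M.funMap VFunc.residueNeg (Env.cons a Env.nil)⟩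
instance : Add (ResidueSort M) :=
  ⟨fun a b => M.funMap VFunc.residueAdd (Env.cons a (Env.cons b Env.nil))⟩
instance : Mul (ResidueSort M) :=
  ⟨fun a b => M.funMap VFunc.residueMul (Env.cons a (Env.cons b Env.nil))⟩

instance : Zero (ValueSort M) := ⟨M.funMap VFunc.valueZero Env.nil⟩
instance : Top (ValueSort M) := ⟨M.funMap VFunc.valueTop Env.nil⟩
instance : Add (ValueSort M) :=
  ⟨fun a b => M.funMap VFunc.valueAdd (Env.cons a (Env.cons b Env.nil))⟩
instance : LE (ValueSort M) :=
  ⟨fun a b => M.relMap VRel.valueLE (Env.cons a (Env.cons b Env.nil))⟩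

/-- The valuation of a structure. -/
def valMap (a : FieldSort M) : ValueSort M := M.funMap VFunc.val (Env.cons a Env.nil)

/-- The residue map of a structure. -/
def projMap (a : FieldSort M) : ResidueSort M := M.funMap VFunc.proj (Env.cons a Env.nil)

/-- The lift of the residue field of a structure. -/
def liftMap (a : ResidueSort M) : FieldSort M := M.funMap VFunc.lift (Env.cons a Env.nil)

/-- The total residue map of a structure. -/
def resMap (a : FieldSort M) : ResidueSort M := M.funMap VFunc.res (Env.cons a Env.nil)

/-- Membership in the valuation ring. -/
def IsInt (a : FieldSort M) : Prop := (0 : ValueSort M) ≤ valMap a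

section Realize

variable {l : List VSort} (ρ : Env M.carrier l)

theorem realize_env_nil :
    (fun s i => Term.realize M ρ ((Env.nil : Env (Term Lres l) []) s i)) = Env.nil := by
  funext s x
  cases x

theorem realize_env_one {s : VSort} (t : T l s) :
    (fun s' i => Term.realize M ρ (Env.cons (M := Term Lres l) t Env.nil s' i)) =
      Env.cons (t.realize M ρ) Env.nil := by
  funext s x
  rcases x with _ | _ | _
  rfl

theorem realize_env_two {s s' : VSort} (t : T l s) (t' : T l s') :
    (fun s' i => Term.realize M ρ (Env.cons (M := Term Lres l) t (Env.cons t' Env.nil) s' i)) =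
      Env.cons (t.realize M ρ) (Env.cons (t'.realize M ρ) Env.nil) := by
  funext s x
  rcases x with _ | _ | _ | _ <;> rfl

@[simp] theorem realize_field_zero : Term.realize M ρ (0 : T l .field) = (0 : FieldSort M) :=
  congrArg (M.funMap VFunc.fieldZero) (realize_env_nil ρ)

@[simp] theorem realize_field_one : Term.realize M ρ (1 : T l .field) = (1 : FieldSort M) :=
  congrArg (M.funMap VFunc.fieldOne) (realize_env_nil ρ)

@[simp] theorem realize_field_neg (a : T l .field) :
    Term.realize M ρ (-a) = -(a.realize M ρ : FieldSort M) :=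
  congrArg (M.funMap VFunc.fieldNeg) (realize_env_one ρ a)

@[simp] theorem realize_field_add (a b : T l .field) :
    Term.realize M ρ (a + b) = (a.realize M ρ : FieldSort M) + b.realize M ρ :=
  congrArg (M.funMap VFunc.fieldAdd) (realize_env_two ρ a b)

@[simp] theorem realize_field_mul (a b : T l .field) :
    Term.realize M ρ (a * b) = (a.realize M ρ : FieldSort M) * b.realize M ρ :=
  congrArg (M.funMap VFunc.fieldMul) (realize_env_two ρ a b)

@[simp] theorem realize_residue_zero : Term.realize M ρ (0 : T l .residue) = (0 : ResidueSort M) :=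
  congrArg (M.funMap VFunc.residueZero) (realize_env_nil ρ)

@[simp] theorem realize_residue_one : Term.realize M ρ (1 : T l .residue) = (1 : ResidueSort M) :=
  congrArg (M.funMap VFunc.residueOne) (realize_env_nil ρ)

@[simp] theorem realize_residue_neg (a : T l .residue) :
    Term.realize M ρ (-a) = -(a.realize M ρ : ResidueSort M) :=
  congrArg (M.funMap VFunc.residueNeg) (realize_env_one ρ a)

@[simp] theorem realize_residue_add (a b : T l .residue) :
    Term.realize M ρ (a + b) = (a.realize M ρ : ResidueSort M) + b.realize M ρ :=
  congrArg (M.funMap VFunc.residueAdd) (realize_env_two ρ a b)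

@[simp] theorem realize_residue_mul (a b : T l .residue) :
    Term.realize M ρ (a * b) = (a.realize M ρ : ResidueSort M) * b.realize M ρ :=
  congrArg (M.funMap VFunc.residueMul) (realize_env_two ρ a b)

@[simp] theorem realize_value_zero : Term.realize M ρ (0 : T l .value) = (0 : ValueSort M) :=
  congrArg (M.funMap VFunc.valueZero) (realize_env_nil ρ)

@[simp] theorem realize_value_top : Term.realize M ρ (⊤ : T l .value) = (⊤ : ValueSort M) :=
  congrArg (M.funMap VFunc.valueTop) (realize_env_nil ρ)

@[simp] theorem realize_value_add (a b : T l .value) :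
    Term.realize M ρ (a + b) = (a.realize M ρ : ValueSort M) + b.realize M ρ :=
  congrArg (M.funMap VFunc.valueAdd) (realize_env_two ρ a b)

@[simp] theorem realize_val (a : T l .field) :
    Term.realize M ρ (val a) = valMap (a.realize M ρ) :=
  congrArg (M.funMap VFunc.val) (realize_env_one ρ a)

@[simp] theorem realize_proj (a : T l .field) :
    Term.realize M ρ (proj a) = projMap (a.realize M ρ) :=
  congrArg (M.funMap VFunc.proj) (realize_env_one ρ a)

@[simp] theorem realize_lift (a : T l .residue) :
    Term.realize M ρ (lift a) = liftMap (a.realize M ρ) :=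
  congrArg (M.funMap VFunc.lift) (realize_env_one ρ a)

@[simp] theorem realize_res (a : T l .field) :
    Term.realize M ρ (res a) = resMap (a.realize M ρ) :=
  congrArg (M.funMap VFunc.res) (realize_env_one ρ a)

@[simp] theorem realize_le (a b : T l .value) :
    Formula.Realize M (le a b) ρ ↔ (a.realize M ρ : ValueSort M) ≤ b.realize M ρ :=
  iff_of_eq (congrArg (M.relMap VRel.valueLE) (realize_env_two ρ a b))

@[simp] theorem realize_integral (a : T l .field) :
    Formula.Realize M (integral a) ρ ↔ IsInt (a.realize M ρ : FieldSort M) := by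
  simp [integral, IsInt]

-- `Nat.unaryCast` uses only `0`, `1` and `+`, so it makes sense before any axiom is known to hold.
@[simp] theorem realize_field_numeral (n : ℕ) :
    Term.realize M ρ (numeral n : T l .field) = (Nat.unaryCast n : FieldSort M) := by
  induction n with
  | zero => simp [numeral, Nat.unaryCast]
  | succ n ih => simp [numeral, Nat.unaryCast, ih]

@[simp] theorem realize_residue_numeral (n : ℕ) :
    Term.realize M ρ (numeral n : T l .residue) = (Nat.unaryCast n : ResidueSort M) := by
  induction n with
  | zero => simp [numeral, Nat.unaryCast]
  | succ n ih => simp [numeral, Nat.unaryCast, ih]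

section Variables

variable {s₀ s₁ s₂ s₃ : VSort} (a₀ : M.carrier s₀) (a₁ : M.carrier s₁) (a₂ : M.carrier s₂)
  (a₃ : M.carrier s₃)

@[simp] theorem realize_x0 : Term.realize M (Env.cons a₀ ρ) x0 = a₀ := rfl

@[simp] theorem realize_x1 : Term.realize M (Env.cons a₀ (Env.cons a₁ ρ)) x1 = a₁ := rfl

@[simp] theorem realize_x2 :
    Term.realize M (Env.cons a₀ (Env.cons a₁ (Env.cons a₂ ρ))) x2 = a₂ := rfl

@[simp] theorem realize_x3 :
    Term.realize M (Env.cons a₀ (Env.cons a₁ (Env.cons a₂ (Env.cons a₃ ρ)))) x3 = a₃ := rfl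

end Variables

end Realize

end Operations

end ResidueForm

/-! ### Evaluation of the connectives, and models of explicit lists of axioms -/

namespace MSLanguage

variable {L : MSLanguage} {M : Structure.{u} L} {l : List L.Sorts} {ρ : Env M.carrier l}

namespace Formula

@[simp] theorem realize_equal {s : L.Sorts} (t₁ t₂ : Term L l s) :
    (equal t₁ t₂).Realize M ρ ↔ t₁.realize M ρ = t₂.realize M ρ := Iff.rfl

@[simp] theorem realize_imp (φ ψ : Formula L l) :
    (φ.imp ψ).Realize M ρ ↔ (φ.Realize M ρ → ψ.Realize M ρ) := Iff.rfl

@[simp] theorem realize_all (s : L.Sorts) (φ : Formula L (s :: l)) :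
    (all s φ).Realize M ρ ↔ ∀ a : M.carrier s, φ.Realize M (Env.cons a ρ) := Iff.rfl

@[simp] theorem realize_not (φ : Formula L l) : φ.not.Realize M ρ ↔ ¬ φ.Realize M ρ := Iff.rfl

@[simp] theorem realize_or (φ ψ : Formula L l) :
    (φ.or ψ).Realize M ρ ↔ φ.Realize M ρ ∨ ψ.Realize M ρ := by
  simp only [Formula.or, realize_imp, realize_not]
  tauto

@[simp] theorem realize_and (φ ψ : Formula L l) :
    (φ.and ψ).Realize M ρ ↔ φ.Realize M ρ ∧ ψ.Realize M ρ := by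
  simp only [Formula.and, realize_imp, realize_not]
  tauto

@[simp] theorem realize_iff (φ ψ : Formula L l) :
    (φ.iff ψ).Realize M ρ ↔ (φ.Realize M ρ ↔ ψ.Realize M ρ) := by
  simp only [Formula.iff, realize_imp, realize_and]
  tauto

@[simp] theorem realize_ex (s : L.Sorts) (φ : Formula L (s :: l)) :
    (ex s φ).Realize M ρ ↔ ∃ a : M.carrier s, φ.Realize M (Env.cons a ρ) := by
  simp [Formula.ex]

end Formula

theorem Structure.models_union {T₁ T₂ : Theory L} :
    M.Models (T₁ ∪ T₂) ↔ M.Models T₁ ∧ M.Models T₂ := by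
  simp only [Structure.Models, Set.mem_union, or_imp, forall_and]

theorem Structure.models_insert {φ : Sentence L} {T : Theory L} :
    M.Models (insert φ T) ↔ φ.Realize M Env.nil ∧ M.Models T := by
  simp only [Structure.Models, Set.mem_insert_iff, forall_eq_or_imp]

theorem Structure.models_singleton {φ : Sentence L} :
    M.Models {φ} ↔ φ.Realize M Env.nil := by
  simp only [Structure.Models, Set.mem_singleton_iff, forall_eq]

theorem Structure.models_range {ι : Type*} {φ : ι → Sentence L} :
    M.Models (Set.range φ) ↔ ∀ i, (φ i).Realize M Env.nil := by
  simp only [Structure.Models, Set.forall_mem_range]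

end MSLanguage

/-! ### The axioms as algebraic laws -/

namespace ResidueForm

open MSLanguage

/-- The field axioms for a type with operations. -/
structure FieldLaws (α : Type*) [Zero α] [One α] [Neg α] [Add α] [Mul α] : Prop where
  add_assoc : ∀ a b c : α, a + b + c = a + (b + c)
  add_comm : ∀ a b : α, a + b = b + a
  zero_add : ∀ a : α, 0 + a = a
  neg_add : ∀ a : α, -a + a = 0
  mul_assoc : ∀ a b c : α, a * b * c = a * (b * c)
  mul_comm : ∀ a b : α, a * b = b * a
  one_mul : ∀ a : α, 1 * a = a
  mul_add : ∀ a b c : α, a * (b + c) = a * b + a * c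
  zero_ne_one : ¬ (0 : α) = 1
  exists_inv : ∀ a : α, a = 0 ∨ ∃ b, a * b = 1

/-- The axioms of an ordered abelian group with infinity. -/
structure ValueLaws (α : Type*) [Zero α] [Top α] [Add α] [LE α] : Prop where
  le_refl : ∀ a : α, a ≤ a
  le_trans : ∀ a b c : α, a ≤ b → b ≤ c → a ≤ c
  le_antisymm : ∀ a b : α, a ≤ b → b ≤ a → a = b
  le_total : ∀ a b : α, a ≤ b ∨ b ≤ a
  le_top : ∀ a : α, a ≤ ⊤
  add_assoc : ∀ a b c : α, a + b + c = a + (b + c)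
  add_comm : ∀ a b : α, a + b = b + a
  zero_add : ∀ a : α, 0 + a = a
  top_add : ∀ a : α, ⊤ + a = ⊤
  zero_ne_top : ¬ (0 : α) = ⊤
  exists_neg : ∀ a : α, a = ⊤ ∨ ∃ b, a + b = 0
  add_le_add_right : ∀ a b c : α, a ≤ b → a + c ≤ b + c

/-- The axioms on the valuation, the residue map and the lift. -/
structure ValuedLaws (M : Structure.{u} Lres) : Prop where
  val_eq_top : ∀ a : FieldSort M, valMap a = ⊤ ↔ a = 0
  val_mul : ∀ a b : FieldSort M, valMap (a * b) = valMap a + valMap b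
  val_add : ∀ a b : FieldSort M, valMap a ≤ valMap (a + b) ∨ valMap b ≤ valMap (a + b)
  val_surj : ∀ c : ValueSort M, ∃ a, valMap a = c
  proj_add : ∀ a b : FieldSort M, IsInt a → IsInt b → projMap (a + b) = projMap a + projMap b
  proj_mul : ∀ a b : FieldSort M, IsInt a → IsInt b → projMap (a * b) = projMap a * projMap b
  proj_one : projMap (1 : FieldSort M) = 1
  proj_eq_zero : ∀ a : FieldSort M, IsInt a → (projMap a = 0 ↔ ¬ valMap a = 0)
  proj_surj : ∀ c : ResidueSort M, ∃ a, IsInt a ∧ projMap a = c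
  proj_of_not_isInt : ∀ a : FieldSort M, ¬ IsInt a → projMap a = 0
  char_iff : ∀ n : ℕ, (Nat.unaryCast n : FieldSort M) = 0 ↔ (Nat.unaryCast n : ResidueSort M) = 0
  lift_add : ∀ a b : ResidueSort M, liftMap (a + b) = liftMap a + liftMap b
  lift_mul : ∀ a b : ResidueSort M, liftMap (a * b) = liftMap a * liftMap b
  lift_one : liftMap (1 : ResidueSort M) = 1
  isInt_lift : ∀ a : ResidueSort M, IsInt (liftMap a)
  proj_lift : ∀ a : ResidueSort M, projMap (liftMap a) = a

/-- The axioms on the total residue map. -/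
structure ResLaws (M : Structure.{u} Lres) : Prop where
  res_of_isInt : ∀ a : FieldSort M, IsInt a → resMap a = projMap a
  res_linear : ∀ (c d : ResidueSort M) (a b : FieldSort M),
    resMap (liftMap c * a + liftMap d * b) = c * resMap a + d * resMap b

/-- The axioms of `VFresLift`, in terms of the operations of the structure. -/
class IsModel (M : Structure.{u} Lres) : Prop where
  fieldLaws : FieldLaws (FieldSort M)
  residueLaws : FieldLaws (ResidueSort M)
  valueLaws : ValueLaws (ValueSort M)
  valuedLaws : ValuedLaws M
  resLaws : ResLaws M

theorem models_fieldAxioms_field {M : Structure.{u} Lres} :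
    M.Models (fieldAxioms .field) ↔ FieldLaws (FieldSort M) := by
  unfold fieldAxioms
  repeat rw [Structure.models_insert]
  rw [Structure.models_singleton]
  simp
  constructor
  · rintro ⟨h1, h2, h3, h4, h5, h6, h7, h8, h9, h10⟩
    exact ⟨h1, h2, h3, h4, h5, h6, h7, h8, h9, h10⟩
  · rintro ⟨h1, h2, h3, h4, h5, h6, h7, h8, h9, h10⟩
    exact ⟨h1, h2, h3, h4, h5, h6, h7, h8, h9, h10⟩

theorem models_fieldAxioms_residue {M : Structure.{u} Lres} :
    M.Models (fieldAxioms .residue) ↔ FieldLaws (ResidueSort M) := by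
  unfold fieldAxioms
  repeat rw [Structure.models_insert]
  rw [Structure.models_singleton]
  simp
  constructor
  · rintro ⟨h1, h2, h3, h4, h5, h6, h7, h8, h9, h10⟩
    exact ⟨h1, h2, h3, h4, h5, h6, h7, h8, h9, h10⟩
  · rintro ⟨h1, h2, h3, h4, h5, h6, h7, h8, h9, h10⟩
    exact ⟨h1, h2, h3, h4, h5, h6, h7, h8, h9, h10⟩

theorem models_valueAxioms {M : Structure.{u} Lres} :
    M.Models valueAxioms ↔ ValueLaws (ValueSort M) := by
  unfold valueAxioms
  repeat rw [Structure.models_insert]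
  rw [Structure.models_singleton]
  simp
  constructor
  · rintro ⟨h1, h2, h3, h4, h5, h6, h7, h8, h9, h10, h11, h12⟩
    exact ⟨h1, h2, h3, h4, h5, h6, h7, h8, h9, h10, h11, h12⟩
  · rintro ⟨h1, h2, h3, h4, h5, h6, h7, h8, h9, h10, h11, h12⟩
    exact ⟨h1, h2, h3, h4, h5, h6, h7, h8, h9, h10, h11, h12⟩

theorem models_valuedAxioms {M : Structure.{u} Lres} :
    (M.Models valuationAxioms ∧ M.Models projAxioms ∧ M.Models equalCharAxioms ∧
      M.Models liftAxioms) ↔ ValuedLaws M := by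
  unfold valuationAxioms projAxioms equalCharAxioms liftAxioms
  repeat rw [Structure.models_insert]
  rw [Structure.models_singleton, Structure.models_singleton, Structure.models_range,
    Structure.models_singleton]
  simp
  constructor
  · rintro ⟨⟨h1, h2, h3, h4⟩, ⟨h5, h6, h7, h8, h9, h10⟩, h11, h12, h13, h14, h15, h16⟩
    exact ⟨h1, h2, h3, h4, h5, h6, h7, h8, h9, h10, h11, h12, h13, h14, h15, h16⟩
  · rintro ⟨h1, h2, h3, h4, h5, h6, h7, h8, h9, h10, h11, h12, h13, h14, h15, h16⟩
    exact ⟨⟨h1, h2, h3, h4⟩, ⟨h5, h6, h7, h8, h9, h10⟩, h11, h12, h13, h14, h15, h16⟩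

theorem models_resAxioms {M : Structure.{u} Lres} : M.Models resAxioms ↔ ResLaws M := by
  unfold resAxioms
  repeat rw [Structure.models_insert]
  rw [Structure.models_singleton]
  simp
  constructor
  · rintro ⟨h1, h2⟩
    exact ⟨h1, h2⟩
  · rintro ⟨h1, h2⟩
    exact ⟨h1, h2⟩

theorem models_iff {M : Structure.{u} Lres} : M.Models VFresLift ↔ IsModel M := by
  simp only [VFresLift, Structure.models_union, models_fieldAxioms_field,
    models_fieldAxioms_residue, models_valueAxioms, models_resAxioms, and_assoc]
  constructor
  · rintro ⟨h1, h2, h3, h4, h5, h6, h7, h8⟩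
    exact ⟨h1, h2, h3, models_valuedAxioms.1 ⟨h4, h5, h6, h7⟩, h8⟩
  · rintro ⟨h1, h2, h3, h4, h5⟩
    obtain ⟨h4, h6, h7, h8⟩ := models_valuedAxioms.2 h4
    exact ⟨h1, h2, h3, h4, h6, h7, h8, h5⟩

end ResidueForm

/-! ### Algebra inside a model -/

namespace ResidueForm
open MSLanguage

section Model

/-- A field from operations satisfying the field axioms. -/
noncomputable abbrev FieldLaws.toField {α : Type*} [Zero α] [One α] [Neg α] [Add α] [Mul α]
    (h : FieldLaws α) : Field α :=
  haveI := Classical.decEq α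
  letI : Inv α := ⟨fun a => if ha : a = 0 then 0 else ((h.exists_inv a).resolve_left ha).choose⟩
  Field.ofMinimalAxioms α h.add_assoc h.zero_add h.neg_add h.mul_assoc h.mul_comm h.one_mul
    (fun a ha =>
      (congrArg (a * ·) (dif_neg ha)).trans ((h.exists_inv a).resolve_left ha).choose_spec)
    (dif_pos rfl) h.mul_add ⟨0, 1, h.zero_ne_one⟩

variable {M : Structure.{u} Lres} [hM : IsModel M]

noncomputable instance : Field (FieldSort M) := hM.fieldLaws.toField

noncomputable instance : Field (ResidueSort M) := hM.residueLaws.toField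

variable (M) in
/-- The lift as a ring homomorphism. -/
noncomputable def liftHom : ResidueSort M →+* FieldSort M :=
  RingHom.mk' ⟨⟨liftMap, hM.valuedLaws.lift_one⟩, hM.valuedLaws.lift_mul⟩ hM.valuedLaws.lift_add

noncomputable instance : Algebra (ResidueSort M) (FieldSort M) := (liftHom M).toAlgebra

theorem algebraMap_eq (c : ResidueSort M) :
    algebraMap (ResidueSort M) (FieldSort M) c = liftMap c := rfl

theorem smul_eq (c : ResidueSort M) (a : FieldSort M) : c • a = liftMap c * a :=
  Algebra.smul_def c a

theorem IsInt.mul {a b : FieldSort M} (ha : IsInt a) (hb : IsInt b) : IsInt (a * b) := by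
  have h := hM.valueLaws
  unfold IsInt at *
  rw [hM.valuedLaws.val_mul]
  refine h.le_trans _ _ _ hb ?_
  have := h.add_le_add_right _ _ (valMap b) ha
  rwa [h.zero_add] at this

theorem IsInt.add {a b : FieldSort M} (ha : IsInt a) (hb : IsInt b) : IsInt (a + b) := by
  have h := hM.valueLaws
  rcases hM.valuedLaws.val_add a b with hab | hab
  · exact h.le_trans _ _ _ ha hab
  · exact h.le_trans _ _ _ hb hab

variable (M) in
/-- The valuation ring, as an algebra over the residue field. -/
noncomputable def intAlgebra : Subalgebra (ResidueSort M) (FieldSort M) where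
  carrier := {a | IsInt a}
  mul_mem' := IsInt.mul
  add_mem' := IsInt.add
  algebraMap_mem' c := hM.valuedLaws.isInt_lift c

variable (M) in
/-- The valuation ring, as a vector space over the residue field. -/
noncomputable def intSubmodule : Submodule (ResidueSort M) (FieldSort M) := (intAlgebra M).toSubmodule

theorem mem_intSubmodule {a : FieldSort M} : a ∈ intSubmodule M ↔ IsInt a := Iff.rfl

theorem IsInt.inv {a : FieldSort M} (ha : IsInt a) (ha' : projMap a ≠ 0) : IsInt a⁻¹ := by
  have hv := hM.valuedLaws
  -- This is not an axiom; it follows from `π(1) = 1 ≠ 0`.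
  have h1 : valMap (1 : FieldSort M) = 0 := by
    by_contra h
    have := (hv.proj_eq_zero 1 (one_mem (intAlgebra M))).2 h
    rw [hv.proj_one] at this
    exact one_ne_zero this
  have hva : valMap a = 0 := by
    by_contra h
    exact ha' ((hv.proj_eq_zero a ha).2 h)
  have ha0 : a ≠ 0 := by
    rintro rfl
    exact hM.valueLaws.zero_ne_top (hva ▸ (hv.val_eq_top 0).2 rfl)
  have := hv.val_mul a a⁻¹
  rw [mul_inv_cancel₀ ha0, h1, hva, hM.valueLaws.zero_add] at this
  unfold IsInt
  rw [← this]
  exact hM.valueLaws.le_refl _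

/-- An integral element with nonzero residue is a unit of the valuation ring and can be cancelled.
-/
theorem IsInt.of_mul {a b : FieldSort M} (h : IsInt (a * b)) (hb : IsInt b)
    (hb' : projMap b ≠ 0) : IsInt a := by
  have hb0 : b ≠ 0 := by
    rintro rfl
    have := hM.valuedLaws.proj_lift 0
    rw [← algebraMap_eq, map_zero] at this
    exact hb' this
  have := h.mul (hb.inv hb')
  rwa [mul_assoc, mul_inv_cancel₀ hb0, mul_one] at this

variable (M) in
/-- The total residue map as a linear map. -/
noncomputable def resHom : FieldSort M →ₗ[ResidueSort M] ResidueSort M where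
  toFun := resMap
  map_add' a b := by
    have := hM.resLaws.res_linear 1 1 a b
    rwa [hM.valuedLaws.lift_one, one_mul, one_mul, one_mul, one_mul] at this
  map_smul' c a := by
    have := hM.resLaws.res_linear c 0 a 0
    rwa [mul_zero, add_zero, zero_mul, add_zero, ← smul_eq] at this

theorem resHom_apply (a : FieldSort M) : resHom M a = resMap a := rfl

theorem proj_zero : projMap (0 : FieldSort M) = 0 := by
  rw [← hM.resLaws.res_of_isInt 0 (zero_mem (intAlgebra M)), ← resHom_apply, map_zero]

theorem isInt_lift_sub {a : FieldSort M} (ha : IsInt a) (y : ResidueSort M) :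
    IsInt (liftMap y - a) :=
  (intAlgebra M).sub_mem (hM.valuedLaws.isInt_lift y) ha

/-- On integral elements `π` agrees with the linear map `resHom`, so the residue can be taken term
by term. In particular `y - a` is a unit of the valuation ring when `y ≠ 0`. -/
theorem proj_lift_sub {a : FieldSort M} (ha : IsInt a) (ha' : projMap a = 0) (y : ResidueSort M) :
    projMap (liftMap y - a) = y := by
  rw [← hM.resLaws.res_of_isInt _ (isInt_lift_sub ha y), ← resHom_apply, map_sub, resHom_apply,
    resHom_apply, hM.resLaws.res_of_isInt _ (hM.valuedLaws.isInt_lift y),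
    hM.resLaws.res_of_isInt _ ha, ha', hM.valuedLaws.proj_lift, sub_zero]

theorem lift_sub_ne_zero {a : FieldSort M} (ha : IsInt a) (ha' : projMap a = 0)
    {y : ResidueSort M} (hy : y ≠ 0) : liftMap y - a ≠ 0 := by
  intro h
  have := proj_lift_sub ha ha' y
  rw [h, proj_zero] at this
  exact hy this.symm

open Polynomial in
theorem isInt_aeval {a : FieldSort M} (ha : IsInt a) (Q : (ResidueSort M)[X]) :
    IsInt (aeval a Q) := by
  have := (aeval (⟨a, ha⟩ : intAlgebra M) Q).2
  rwa [← Subalgebra.aeval_coe] at this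

open Polynomial in
-- Modulo the maximal ideal, `Q(a)` is `Q(0)`.
theorem proj_aeval {a : FieldSort M} (ha : IsInt a) (ha' : projMap a = 0)
    (Q : (ResidueSort M)[X]) : projMap (aeval a Q) = Q.coeff 0 := by
  have hv := hM.valuedLaws
  have hi := isInt_aeval ha Q.divX
  conv_lhs => rw [← divX_mul_X_add Q]
  rw [map_add, map_mul, aeval_X, aeval_C, algebraMap_eq,
    hv.proj_add _ _ (hi.mul ha) (hv.isInt_lift _), hv.proj_mul _ _ hi ha, ha', mul_zero, zero_add,
    hv.proj_lift]

open Polynomial in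
/-- A nonzero polynomial over the residue field takes at `a` a value of order a multiple of that
of `a`. -/
theorem exists_isInt_mul_pow {a b : FieldSort M} (ha : IsInt a) (ha' : projMap a = 0)
    {Q : (ResidueSort M)[X]} (hQ : Q ≠ 0) (h : IsInt (b * aeval a Q)) :
    ∃ n : ℕ, IsInt (b * a ^ n) := by
  -- Write `Q = X ^ n * R` with `R(0) ≠ 0`; then `R(a)` is a unit of the valuation ring, so `b *
  -- Q(a)` is integral only if `b * a ^ n` is.
  obtain ⟨R, hR, hR'⟩ := exists_eq_pow_rootMultiplicity_mul_and_not_dvd Q hQ 0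
  refine ⟨rootMultiplicity 0 Q, IsInt.of_mul (b := aeval a R) ?_ (isInt_aeval ha R) ?_⟩
  · rw [hR] at h
    simpa [mul_assoc] using h
  · rw [proj_aeval ha ha']
    rwa [C_0, sub_zero, X_dvd_iff] at hR'

open Polynomial in
-- Clearing denominators in a linear relation modulo the valuation ring makes `b * Q(a)` integral
-- for a polynomial `Q` over the residue field. By `exists_isInt_mul_pow` this forces `Q = 0`, and
-- the values of `Q` at the distinct points `y i` recover the coefficients, as in Lagrange
-- interpolation.
theorem linearIndependent_div {a b : FieldSort M} (ha : IsInt a) (ha' : projMap a = 0)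
    (hb : ∀ n : ℕ, ¬ IsInt (b * a ^ n)) {y : ℕ → ResidueSort M} (hy : Function.Injective y)
    (hy' : ∀ n, y n ≠ 0) :
    LinearIndependent (ResidueSort M)
      (fun n => (intSubmodule M).mkQ (b * (liftMap (y n) - a)⁻¹)) := by
  classical
  rw [linearIndependent_iff']
  intro s g hg
  simp only [← map_smul, ← map_sum] at hg
  rw [Submodule.mkQ_apply, Submodule.Quotient.mk_eq_zero, mem_intSubmodule] at hg
  -- The numerator of `∑ g i / (y i - X)` over the common denominator `∏ (y j - X)`.
  set Q : (ResidueSort M)[X] := ∑ i ∈ s, C (g i) * ∏ j ∈ s.erase i, (C (y j) - X) with hQ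
  have haeval : b * aeval a Q =
      (∑ i ∈ s, g i • (b * (liftMap (y i) - a)⁻¹)) * ∏ j ∈ s, (liftMap (y j) - a) := by
    rw [hQ, map_sum, Finset.mul_sum, Finset.sum_mul]
    refine Finset.sum_congr rfl fun i hi => ?_
    rw [← Finset.mul_prod_erase s _ hi, map_mul, map_prod, aeval_C, smul_eq, algebraMap_eq]
    simp only [map_sub, aeval_C, aeval_X, algebraMap_eq]
    have := lift_sub_ne_zero ha ha' (hy' i)
    field_simp
  have h_int : IsInt (b * aeval a Q) := by
    rw [haeval]
    exact hg.mul ((intAlgebra M).prod_mem fun j _ => isInt_lift_sub ha (y j))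
  have hQ0 : Q = 0 := by
    by_contra h
    obtain ⟨n, hn⟩ := exists_isInt_mul_pow ha ha' h h_int
    exact hb n hn
  intro i hi
  -- Every other summand contains the factor `y i - X`, which vanishes at `y i`.
  have heval : Q.eval (y i) = g i * ∏ j ∈ s.erase i, (y j - y i) := by
    rw [hQ, eval_finsetSum, Finset.sum_eq_single i]
    · simp [eval_prod]
    · intro k hk hki
      rw [eval_mul, eval_prod, Finset.prod_eq_zero (i := i), mul_zero]
      · exact Finset.mem_erase.2 ⟨hki.symm, hi⟩
      · simp
    · exact fun h => (h hi).elim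
  rw [hQ0, eval_zero] at heval
  refine (mul_eq_zero.1 heval.symm).resolve_right (Finset.prod_ne_zero_iff.2 fun j hj => ?_)
  exact sub_ne_zero.2 fun h => (Finset.mem_erase.1 hj).1 (hy h)

/-- Only finitely many of the elements `b / (y n - a)` lie in a subspace of finite dimension
modulo the valuation ring. -/
theorem finite_div_mem {a b : FieldSort M} (ha : IsInt a) (ha' : projMap a = 0)
    (hb : ∀ n : ℕ, ¬ IsInt (b * a ^ n)) {y : ℕ → ResidueSort M} (hy : Function.Injective y)
    (hy' : ∀ n, y n ≠ 0) {C : Submodule (ResidueSort M) (FieldSort M)} (hC : C.FG) :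
    {n | b * (liftMap (y n) - a)⁻¹ ∈ intSubmodule M ⊔ C}.Finite := by
  have hli := linearIndependent_div ha ha' hb hy hy'
  set S := {n | b * (liftMap (y n) - a)⁻¹ ∈ intSubmodule M ⊔ C}
  let D := C.map (intSubmodule M).mkQ
  have : Module.Finite (ResidueSort M) D := Module.Finite.iff_fg.2 (hC.map _)
  have hD : ∀ n : S, (intSubmodule M).mkQ (b * (liftMap (y n) - a)⁻¹) ∈ D := by
    rintro ⟨n, hn⟩
    have := Submodule.mem_map_of_mem (f := (intSubmodule M).mkQ) (Set.mem_ofPred.1 hn)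
    rwa [Submodule.map_sup, Submodule.mkQ_map_self, bot_sup_eq] at this
  have h2 : LinearIndependent (ResidueSort M) (fun n : S => (⟨_, hD n⟩ : D)) :=
    LinearIndependent.of_comp D.subtype (hli.comp (Subtype.val : S → ℕ) Subtype.val_injective)
  exact Set.finite_coe_iff.1 h2.finite_of_isNoetherian

/-- If all `res (b * a ^ n)` vanish, and `b * a ^ n` is integral for some `n`, then
`res (b / (y - a))` vanishes for all `y` in the lift of the residue field. -/
theorem res_div_eq_zero {a b : FieldSort M} (ha : IsInt a) (ha' : projMap a = 0)
    (hb : ∀ n : ℕ, resMap (b * a ^ n) = 0) (hb' : ∃ n : ℕ, IsInt (b * a ^ n))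
    {y : ResidueSort M} (hy : y ≠ 0) {z : FieldSort M} (hz : z * (liftMap y - a) = b) :
    resMap z = 0 := by
  have hv := hM.valuedLaws
  obtain ⟨m, hm⟩ := hb'
  have hzm : b * a ^ m = z * a ^ m * (liftMap y - a) := by rw [← hz]; ring
  have hpy : projMap (liftMap y - a) = y := proj_lift_sub ha ha' y
  -- `y - a` is a unit of the valuation ring, so `z * a ^ m` inherits integrality from `b * a ^ m`.
  have hzi : IsInt (z * a ^ m) :=
    IsInt.of_mul (hzm ▸ hm) (isInt_lift_sub ha y) (by rwa [hpy])
  have h0 : resMap (z * a ^ m) = 0 := by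
    have h := hb m
    rw [hM.resLaws.res_of_isInt _ hm, hzm, hv.proj_mul _ _ hzi (isInt_lift_sub ha y), hpy] at h
    rw [hM.resLaws.res_of_isInt _ hzi]
    exact (mul_eq_zero.1 h).resolve_right hy
  -- Descending induction on the exponent, down to `0`. Integrality is lost for smaller exponents,
  -- so only the vanishing `h0` is carried along.
  clear hzm hzi hm
  induction m with
  | zero => simpa using h0
  | succ m ih =>
    refine ih ?_
    -- This is `z * (y - a) = b` multiplied by `a ^ m`. Applying the linear map `res` passes from `z
    -- * a ^ (m + 1)` to `z * a ^ m`.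
    have h1 : y • (z * a ^ m) = b * a ^ m + z * a ^ (m + 1) := by
      rw [smul_eq, ← hz]; ring
    have h2 := congrArg (resHom M) h1
    rw [map_smul, map_add, resHom_apply, resHom_apply, resHom_apply, hb, h0, add_zero,
      smul_eq_mul] at h2
    exact (mul_eq_zero.1 h2).resolve_left hy

end Model

end ResidueForm

/-! ### The Laurent series form a model -/

namespace ResidueForm
open MSLanguage

section Laurent

variable (F : Type u) [Field F]

/-- The sorts of the field of Laurent series. -/
abbrev LaurentCarrier : VSort → Type u
  | .field => HahnSeries ℤ F
  | .value => ULift.{u} (WithTop ℤ)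
  | .residue => F

open scoped Classical in
/-- The field of Laurent series, where the total residue map is the constant coefficient. -/
noncomputable def laurent : Structure.{u} Lres where
  carrier := LaurentCarrier F
  funMap
    | .fieldZero, _ => (0 : HahnSeries ℤ F)
    | .fieldOne, _ => (1 : HahnSeries ℤ F)
    | .fieldNeg, ρ => (-(ρ .field .zero) : HahnSeries ℤ F)
    | .fieldAdd, ρ => (ρ .field .zero + ρ .field (.succ .zero) : HahnSeries ℤ F)
    | .fieldMul, ρ => (ρ .field .zero * ρ .field (.succ .zero) : HahnSeries ℤ F)
    | .residueZero, _ => (0 : F)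
    | .residueOne, _ => (1 : F)
    | .residueNeg, ρ => (-(ρ .residue .zero) : F)
    | .residueAdd, ρ => (ρ .residue .zero + ρ .residue (.succ .zero) : F)
    | .residueMul, ρ => (ρ .residue .zero * ρ .residue (.succ .zero) : F)
    | .valueZero, _ => ULift.up (0 : WithTop ℤ)
    | .valueTop, _ => ULift.up (⊤ : WithTop ℤ)
    | .valueAdd, ρ => ULift.up ((ρ .value .zero).down + (ρ .value (.succ .zero)).down)
    | .val, ρ => ULift.up (ρ .field .zero).orderTop
    | .proj, ρ =>
      (if 0 ≤ (ρ .field .zero).orderTop then (ρ .field .zero).coeff 0 else 0 : F)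
    | .lift, ρ => (HahnSeries.C (ρ .residue .zero) : HahnSeries ℤ F)
    | .res, ρ => ((ρ .field .zero).coeff 0 : F)
  relMap _ ρ := (ρ .value .zero).down ≤ (ρ .value (.succ .zero)).down

end Laurent

section

open HahnSeries

variable {F : Type u} [Field F]

theorem orderTop_sub_C_pos {x : HahnSeries ℤ F} (hx : 0 ≤ x.orderTop) :
    0 < (x - C (x.coeff 0)).orderTop := by
  by_contra! h
  cases ho : (x - C (x.coeff 0)).orderTop with
  | top =>
    rw [ho] at h
    exact absurd h (by simp)
  | coe n =>
    have hn : n ≤ 0 := by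
      rw [ho] at h
      exact_mod_cast h
    refine coeff_orderTop_ne ho ?_
    rcases hn.lt_or_eq with hlt | rfl
    · have h1 : x.coeff n = 0 := coeff_eq_zero_of_lt_orderTop
        (lt_of_lt_of_le (by exact_mod_cast hlt) hx)
      rw [coeff_sub, h1, C_apply, coeff_single_of_ne hlt.ne, sub_zero]
    · simp [C_apply]

/-- Split off the constant term of `x`: the rest has positive order and contributes nothing to the
constant coefficient of the product. -/
theorem coeff_zero_mul {x y : HahnSeries ℤ F} (hx : 0 ≤ x.orderTop) (hy : 0 ≤ y.orderTop) :
    (x * y).coeff 0 = x.coeff 0 * y.coeff 0 := by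
  have h : x * y = C (x.coeff 0) * y + (x - C (x.coeff 0)) * y := by ring
  have h2 : ((x - C (x.coeff 0)) * y).coeff 0 = 0 := by
    refine coeff_eq_zero_of_lt_orderTop ?_
    rw [orderTop_mul]
    exact add_pos_of_pos_of_nonneg (orderTop_sub_C_pos hx) hy
  rw [h, coeff_add, h2, C_mul_eq_smul, coeff_smul, smul_eq_mul, add_zero]

theorem orderTop_eq_zero_iff {x : HahnSeries ℤ F} (hx : 0 ≤ x.orderTop) :
    x.coeff 0 = 0 ↔ ¬ x.orderTop = 0 := by
  constructor
  · exact fun h h' => coeff_orderTop_ne (g := 0) h' h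
  · exact fun h => coeff_eq_zero_of_lt_orderTop (lt_of_le_of_ne hx (Ne.symm h))

theorem orderTop_C_nonneg (c : F) : 0 ≤ (C c : HahnSeries ℤ F).orderTop := orderTop_single_le

end

section

variable {F : Type u} [Field F]

theorem fieldLaws_of_field (α : Type*) [Field α] : FieldLaws α where
  add_assoc := add_assoc
  add_comm := add_comm
  zero_add := zero_add
  neg_add := neg_add_cancel
  mul_assoc := mul_assoc
  mul_comm := mul_comm
  one_mul := one_mul
  mul_add := mul_add
  zero_ne_one := zero_ne_one
  exists_inv a := (eq_or_ne a 0).imp_right fun h => ⟨a⁻¹, mul_inv_cancel₀ h⟩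

theorem unaryCast_eq_natCast {α : Type*} [Ring α] (n : ℕ) : (Nat.unaryCast n : α) = n := by
  induction n with
  | zero => exact Nat.cast_zero.symm
  | succ n ih => rw [Nat.cast_succ, ← ih]; rfl

/-- Each operation of `laurent F` unfolds to one of `HahnSeries ℤ F`, `WithTop ℤ` or `F`; `ULift`
only adjusts the universe of the value sort. -/
theorem laurent_valueLaws : ValueLaws (ValueSort (laurent F)) where
  le_refl a := le_refl a.down
  le_trans _ _ _ h h' := le_trans (α := WithTop ℤ) h h'
  le_antisymm _ _ h h' := ULift.ext _ _ (le_antisymm (α := WithTop ℤ) h h')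
  le_total a b := le_total a.down b.down
  le_top a := le_top (a := a.down)
  add_assoc a b c := ULift.ext _ _ (add_assoc a.down b.down c.down)
  add_comm a b := ULift.ext _ _ (add_comm a.down b.down)
  zero_add a := ULift.ext _ _ (zero_add a.down)
  top_add a := ULift.ext _ _ (top_add a.down)
  zero_ne_top h := WithTop.zero_ne_top (congrArg ULift.down h)
  exists_neg := by
    rintro ⟨a⟩
    cases a with
    | top => exact Or.inl rfl
    | coe n =>
      refine Or.inr ⟨ULift.up ((-n : ℤ) : WithTop ℤ), ULift.ext _ _ ?_⟩
      exact congrArg WithTop.some (add_neg_cancel n)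
  add_le_add_right a b c h := add_le_add_left (α := WithTop ℤ) h c.down

theorem laurent_proj {x : HahnSeries ℤ F} (hx : 0 ≤ x.orderTop) :
    projMap (M := laurent F) x = x.coeff 0 := if_pos hx

theorem laurent_valuedLaws : ValuedLaws (laurent F) where
  val_eq_top a := by
    refine Iff.trans ?_ (HahnSeries.orderTop_eq_top (x := (a : HahnSeries ℤ F)))
    exact ⟨fun h => congrArg ULift.down h, fun h => ULift.ext _ _ h⟩
  val_mul a b := ULift.ext _ _ (HahnSeries.orderTop_mul (a : HahnSeries ℤ F) b)
  val_add a b := min_le_iff.1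
    (HahnSeries.min_orderTop_le_orderTop_add (x := (a : HahnSeries ℤ F)) (y := b))
  val_surj := by
    rintro ⟨a⟩
    cases a with
    | top => exact ⟨(0 : HahnSeries ℤ F), ULift.ext _ _ HahnSeries.orderTop_zero⟩
    | coe n =>
      exact ⟨(HahnSeries.single n (1 : F) : HahnSeries ℤ F),
        ULift.ext _ _ (HahnSeries.orderTop_single one_ne_zero)⟩
  proj_add a b ha hb := by
    refine Eq.trans ?_ (congrArg₂ (fun c d : F => c + d) (laurent_proj ha) (laurent_proj hb)).symm
    exact laurent_proj (le_trans (le_min ha hb) HahnSeries.min_orderTop_le_orderTop_add)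
  proj_mul a b ha hb := by
    refine Eq.trans ?_ (congrArg₂ (fun c d : F => c * d) (laurent_proj ha) (laurent_proj hb)).symm
    refine Eq.trans (laurent_proj (F := F) ?_) (coeff_zero_mul (F := F) (x := a) ha hb)
    exact (add_nonneg ha hb).trans_eq (HahnSeries.orderTop_mul (R := F) a b).symm
  proj_one := by
    refine Eq.trans (laurent_proj (x := 1) (orderTop_C_nonneg 1)) ?_
    exact HahnSeries.coeff_single_same 0 (1 : F)
  proj_eq_zero a ha := by
    refine (Eq.congr_left (laurent_proj ha)).trans ?_
    refine (orderTop_eq_zero_iff ha).trans (not_congr ?_)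
    exact ⟨fun h => ULift.ext _ _ h, fun h => congrArg ULift.down h⟩
  proj_surj c := ⟨(HahnSeries.C (c : F) : HahnSeries ℤ F), orderTop_C_nonneg (F := F) c,
    (laurent_proj (orderTop_C_nonneg (F := F) c)).trans (HahnSeries.coeff_single_same 0 (c : F))⟩
  proj_of_not_isInt a ha := if_neg ha
  char_iff n := by
    change (Nat.unaryCast n : HahnSeries ℤ F) = 0 ↔ (Nat.unaryCast n : F) = 0
    rw [unaryCast_eq_natCast, unaryCast_eq_natCast, ← map_natCast (HahnSeries.C : F →+* HahnSeries ℤ F), map_eq_zero]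
  lift_add a b := map_add (HahnSeries.C : F →+* HahnSeries ℤ F) a b
  lift_mul a b := map_mul (HahnSeries.C : F →+* HahnSeries ℤ F) a b
  lift_one := map_one (HahnSeries.C : F →+* HahnSeries ℤ F)
  isInt_lift c := orderTop_C_nonneg (F := F) c
  proj_lift c :=
    (laurent_proj (orderTop_C_nonneg (F := F) c)).trans (HahnSeries.coeff_single_same 0 (c : F))

theorem laurent_resLaws : ResLaws (laurent F) where
  res_of_isInt a ha := (laurent_proj ha).symm
  res_linear := by
    intro (c : F) (d : F) (a : HahnSeries ℤ F) (b : HahnSeries ℤ F)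
    change (HahnSeries.C c * a + HahnSeries.C d * b).coeff 0 = c * a.coeff 0 + d * b.coeff 0
    rw [HahnSeries.C_mul_eq_smul, HahnSeries.C_mul_eq_smul, HahnSeries.coeff_add,
      HahnSeries.coeff_smul, HahnSeries.coeff_smul, smul_eq_mul, smul_eq_mul]

instance : IsModel (laurent F) where
  fieldLaws := fieldLaws_of_field (HahnSeries ℤ F)
  residueLaws := fieldLaws_of_field F
  valueLaws := laurent_valueLaws
  valuedLaws := laurent_valuedLaws
  resLaws := laurent_resLaws

end

end ResidueForm

/-! ### Embeddings and the operations -/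

namespace ResidueForm
open MSLanguage

section Embedding

variable {M N : Structure.{u} Lres} (e : Embedding M N)

theorem map_field_add (a b : FieldSort M) :
    e.toFun VSort.field (a + b) = e.toFun VSort.field a + e.toFun VSort.field b :=
  (e.map_fun VFunc.fieldAdd (Env.cons a (Env.cons b Env.nil))).trans
    (congrArg (N.funMap VFunc.fieldAdd) (by
      funext s x
      rcases x with _ | _ | _ | _ <;> rfl))

theorem map_field_mul (a b : FieldSort M) :
    e.toFun VSort.field (a * b) = e.toFun VSort.field a * e.toFun VSort.field b :=
  (e.map_fun VFunc.fieldMul (Env.cons a (Env.cons b Env.nil))).trans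
    (congrArg (N.funMap VFunc.fieldMul) (by
      funext s x
      rcases x with _ | _ | _ | _ <;> rfl))

theorem map_field_neg (a : FieldSort M) :
    e.toFun VSort.field (-a) = -(e.toFun VSort.field a : FieldSort N) :=
  (e.map_fun VFunc.fieldNeg (Env.cons a Env.nil)).trans
    (congrArg (N.funMap VFunc.fieldNeg) (by
      funext s x
      rcases x with _ | _ | _
      rfl))

theorem map_residue_zero : e.toFun VSort.residue (0 : ResidueSort M) = (0 : ResidueSort N) :=
  (e.map_fun VFunc.residueZero Env.nil).trans
    (congrArg (N.funMap VFunc.residueZero) (Env.nil_eq _))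

theorem map_valueZero : e.toFun VSort.value (0 : ValueSort M) = (0 : ValueSort N) :=
  (e.map_fun VFunc.valueZero Env.nil).trans
    (congrArg (N.funMap VFunc.valueZero) (Env.nil_eq _))

theorem map_valMap (a : FieldSort M) :
    e.toFun VSort.value (valMap a) = valMap (e.toFun VSort.field a) :=
  (e.map_fun VFunc.val (Env.cons a Env.nil)).trans
    (congrArg (N.funMap VFunc.val) (by
      funext s x
      rcases x with _ | _ | _
      rfl))

theorem map_projMap (a : FieldSort M) :
    e.toFun VSort.residue (projMap a) = projMap (e.toFun VSort.field a) :=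
  (e.map_fun VFunc.proj (Env.cons a Env.nil)).trans
    (congrArg (N.funMap VFunc.proj) (by
      funext s x
      rcases x with _ | _ | _
      rfl))

theorem map_liftMap (a : ResidueSort M) :
    e.toFun VSort.field (liftMap a) = liftMap (e.toFun VSort.residue a) :=
  (e.map_fun VFunc.lift (Env.cons a Env.nil)).trans
    (congrArg (N.funMap VFunc.lift) (by
      funext s x
      rcases x with _ | _ | _
      rfl))

theorem map_resMap (a : FieldSort M) :
    e.toFun VSort.residue (resMap a) = resMap (e.toFun VSort.field a) :=
  (e.map_fun VFunc.res (Env.cons a Env.nil)).trans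
    (congrArg (N.funMap VFunc.res) (by
      funext s x
      rcases x with _ | _ | _
      rfl))

theorem map_le_iff (a b : ValueSort M) :
    (e.toFun VSort.value a : ValueSort N) ≤ e.toFun VSort.value b ↔ a ≤ b :=
  Iff.symm <| (e.map_rel VRel.valueLE (Env.cons a (Env.cons b Env.nil))).trans <|
    iff_of_eq <| congrArg (N.relMap VRel.valueLE) (by
      funext s x
      rcases x with _ | _ | _ | _ <;> rfl)

/-- Embeddings also reflect the order, so non-integrality persists in extensions. -/
theorem map_isInt_iff (a : FieldSort M) : IsInt (M := N) (e.toFun VSort.field a) ↔ IsInt a := by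
  unfold IsInt
  rw [← map_valMap, ← map_valueZero e, map_le_iff]

end Embedding

/-! ### The universal formula, and its evaluation in ultrapowers -/

section Formulas

/-- The formula `res (b / (y - a)) = 0` for all nonzero `y` in the residue field, with free
variables `a` and `b`. -/
def resVanishes : F [.field, .field] :=
  allR <| allK <| .imp (.not (.equal x1 0)) <| .imp (.equal (x0 * (lift x1 + -x2)) x3) <|
    .equal (res x0) 0

/-- The term `b * a ^ n`, with free variables `a` and `b`. -/
def mulPow : ℕ → T [.field, .field] .field
  | 0 => x1
  | n + 1 => mulPow n * x0

/-- The pair `(a, b)` as a tuple. -/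
def pair {M : VSort → Type u} (a b : M .field) : Env M [.field, .field] :=
  Env.cons a (Env.cons b Env.nil)

variable {M N : Structure.{u} Lres}

theorem pair_map (e : ∀ s, M.carrier s → N.carrier s) (a b : FieldSort M) :
    (fun s x => e s (pair (M := M.carrier) a b s x)) =
      pair (M := N.carrier) (e VSort.field a) (e VSort.field b) := by
  funext s x
  rcases x with _ | _ | _ | _ <;> rfl

theorem realize_resVanishes (a b : FieldSort M) :
    resVanishes.Realize M (pair a b) ↔ ∀ (y : ResidueSort M) (z : FieldSort M), ¬ y = 0 →
      z * (liftMap y + -a) = b → resMap z = 0 := by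
  simp only [resVanishes, pair, Formula.realize_all, Formula.realize_imp, Formula.realize_not,
    Formula.realize_equal, realize_field_mul, realize_field_add, realize_field_neg, realize_lift,
    realize_res, realize_residue_zero]
  rfl

theorem realize_mulPow [IsModel M] (a b : FieldSort M) (n : ℕ) :
    (mulPow n).realize M (pair a b) = b * a ^ n := by
  induction n with
  | zero => rw [pow_zero, mul_one]; rfl
  | succ n ih =>
    rw [mulPow, realize_field_mul, ih, pow_succ, mul_assoc]
    rfl

/-- Stated for terms rather than powers, so that it applies to models of the putative companion, for
which no field structure is set up. -/
theorem map_mulPow (e : Embedding M N) (a b : FieldSort M) (n : ℕ) :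
    (mulPow n).realize N (pair (e.toFun VSort.field a) (e.toFun VSort.field b)) =
      e.toFun VSort.field ((mulPow n).realize M (pair a b)) := by
  rw [← e.realize_term, pair_map]

/-- The formula `resVanishes` is universal. -/
theorem resVanishes_of_embedding (e : Embedding M N) {a b : FieldSort M}
    (h : resVanishes.Realize N (pair (e.toFun VSort.field a) (e.toFun VSort.field b))) :
    resVanishes.Realize M (pair a b) := by
  rw [realize_resVanishes] at h ⊢
  intro y z hy hz
  apply e.injective
  rw [map_resMap, map_residue_zero]
  refine h (e.toFun VSort.residue y) _ (fun h0 => hy (e.injective _ ?_)) ?_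
  · rw [h0, map_residue_zero]
  · rw [← hz, map_field_mul, map_field_add, map_field_neg, map_liftMap]

variable {U : Ultrafilter ℕ}

open Structure

theorem pair_mk (a b : ℕ → FieldSort M) :
    (fun s x => ultrapower.mk U (pair (M := fun s => ℕ → M.carrier s) a b s x)) =
      pair (M := (M.ultrapower U).carrier) (ultrapower.mk U a) (ultrapower.mk U b) := by
  funext s x
  rcases x with _ | _ | _ | _ <;> rfl

theorem pair_apply (a b : ℕ → FieldSort M) (n : ℕ) :
    (fun s x => pair (M := fun s => ℕ → M.carrier s) a b s x n) =
      pair (M := M.carrier) (a n) (b n) := by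
  funext s x
  rcases x with _ | _ | _ | _ <;> rfl

theorem ultrapower_realize_pair (φ : F [.field, .field]) (a b : ℕ → FieldSort M) :
    φ.Realize (M.ultrapower U)
        (pair (M := (M.ultrapower U).carrier) (ultrapower.mk U a) (ultrapower.mk U b)) ↔
      ∀ᶠ n in (U : Filter ℕ), φ.Realize M (pair (a n) (b n)) := by
  rw [← pair_mk, ultrapower.realize_formula]
  simp only [pair_apply]

theorem ultrapower_realize_term_pair {s : VSort} (t : T [.field, .field] s)
    (a b : ℕ → FieldSort M) :
    t.realize (M.ultrapower U)
        (pair (M := (M.ultrapower U).carrier) (ultrapower.mk U a) (ultrapower.mk U b)) =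
      ultrapower.mk U fun n => t.realize M (pair (a n) (b n)) := by
  rw [← pair_mk, ultrapower.realize_term]
  simp only [pair_apply]

theorem mk_field_add (a b : ℕ → FieldSort M) :
    (ultrapower.mk U a : FieldSort (M.ultrapower U)) + ultrapower.mk U b =
      ultrapower.mk U fun n => a n + b n := by
  have h := ultrapower_realize_term_pair (U := U) (x0 + x1) a b
  simp only [realize_field_add] at h
  exact h

theorem mk_field_mul (a b : ℕ → FieldSort M) :
    (ultrapower.mk U a : FieldSort (M.ultrapower U)) * ultrapower.mk U b =
      ultrapower.mk U fun n => a n * b n := by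
  have h := ultrapower_realize_term_pair (U := U) (x0 * x1) a b
  simp only [realize_field_mul] at h
  exact h

theorem mk_field_neg (a : ℕ → FieldSort M) :
    -(ultrapower.mk U a : FieldSort (M.ultrapower U)) = ultrapower.mk U fun n => -a n := by
  have h := ultrapower_realize_term_pair (U := U) (-x0) a a
  simp only [realize_field_neg] at h
  exact h

theorem mk_isInt (a : ℕ → FieldSort M) :
    IsInt (M := M.ultrapower U) (ultrapower.mk U a) ↔
      ∀ᶠ n in (U : Filter ℕ), IsInt (a n) := by
  have h := ultrapower_realize_pair (U := U) (integral x0) a a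
  simp only [realize_integral] at h
  exact h

theorem mk_liftMap (c : ℕ → ResidueSort M) :
    liftMap (M := M.ultrapower U) (ultrapower.mk U c) = ultrapower.mk U fun n => liftMap (c n) := by
  have h := ultrapower.realize_term (U := U)
    (Env.cons (M := fun s => ℕ → M.carrier s) c Env.nil)
    (lift x0 : T [.residue] .field)
  simp only [realize_lift] at h
  exact h

end Formulas

end ResidueForm

/-! ### Extensions with a modified total residue map -/

namespace ResidueForm
open MSLanguage Structure

section WithRes

/-- The structure `M` with another total residue map. -/
def withRes (M : Structure.{u} Lres) (f : FieldSort M → ResidueSort M) : Structure.{u} Lres where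
  carrier := M.carrier
  funMap
    | .res, ρ => f (ρ .field .zero)
    | .fieldZero, ρ => M.funMap VFunc.fieldZero ρ
    | .fieldOne, ρ => M.funMap VFunc.fieldOne ρ
    | .fieldNeg, ρ => M.funMap VFunc.fieldNeg ρ
    | .fieldAdd, ρ => M.funMap VFunc.fieldAdd ρ
    | .fieldMul, ρ => M.funMap VFunc.fieldMul ρ
    | .residueZero, ρ => M.funMap VFunc.residueZero ρ
    | .residueOne, ρ => M.funMap VFunc.residueOne ρ
    | .residueNeg, ρ => M.funMap VFunc.residueNeg ρ
    | .residueAdd, ρ => M.funMap VFunc.residueAdd ρ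
    | .residueMul, ρ => M.funMap VFunc.residueMul ρ
    | .valueZero, ρ => M.funMap VFunc.valueZero ρ
    | .valueTop, ρ => M.funMap VFunc.valueTop ρ
    | .valueAdd, ρ => M.funMap VFunc.valueAdd ρ
    | .val, ρ => M.funMap VFunc.val ρ
    | .proj, ρ => M.funMap VFunc.proj ρ
    | .lift, ρ => M.funMap VFunc.lift ρ
  relMap := M.relMap

/-- Only the last two axioms mention `res`; all others are unchanged by definition. -/
theorem isModel_withRes {M : Structure.{u} Lres} [hM : IsModel M]
    (f : FieldSort M →ₗ[ResidueSort M] ResidueSort M) (hf : ∀ a, IsInt a → f a = projMap a) :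
    IsModel (withRes M f) where
  fieldLaws := hM.fieldLaws
  residueLaws := hM.residueLaws
  valueLaws := hM.valueLaws
  valuedLaws :=
    have h := hM.valuedLaws
    ⟨h.val_eq_top, h.val_mul, h.val_add, h.val_surj, h.proj_add, h.proj_mul, h.proj_one,
      h.proj_eq_zero, h.proj_surj, h.proj_of_not_isInt, h.char_iff, h.lift_add, h.lift_mul,
      h.lift_one, h.isInt_lift, h.proj_lift⟩
  resLaws := by
    refine ⟨hf, ?_⟩
    intro (c : ResidueSort M) (d : ResidueSort M) (a : FieldSort M) (b : FieldSort M)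
    have : f (c • a + d • b) = c * f a + d * f b := by
      rw [map_add, map_smul, map_smul, smul_eq_mul, smul_eq_mul]
    exact this

/-- An embedding into `P` that is compatible with the map `f` is an embedding into `P` with the
total residue map `f`. -/
def embeddingWithRes {M P : Structure.{u} Lres} (e : Embedding M P)
    (f : FieldSort P → ResidueSort P)
    (hf : ∀ a : FieldSort M, f (e.toFun VSort.field a) = e.toFun VSort.residue (resMap a)) :
    Embedding M (withRes P f) where
  toFun := e.toFun
  injective := e.injective
  map_fun F xs := by
    cases F with
    | res =>
      refine Eq.trans ?_ (hf (xs .field .zero)).symm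
      refine congrArg (e.toFun VSort.residue) (congrArg (M.funMap VFunc.res) ?_)
      funext s x
      rcases x with _ | _ | _
      rfl
    | _ => exact e.map_fun _ xs
  map_rel := e.map_rel

end WithRes

section Extension

variable {M : Structure.{u} Lres} {U : Ultrafilter ℕ}

instance [hM : IsModel M] : IsModel (M.ultrapower U) :=
  models_iff.1 (Structure.Models.ultrapower (models_iff.2 hM))

/-- The elements of the ultrapower that come from sequences in a finite-dimensional subspace
modulo the valuation ring. -/
noncomputable def finiteDimSubmodule (M : Structure.{u} Lres) [IsModel M] (U : Ultrafilter ℕ) :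
    Submodule (ResidueSort (M.ultrapower U)) (FieldSort (M.ultrapower U)) where
  carrier := {x | ∃ C : Submodule (ResidueSort M) (FieldSort M), C.FG ∧
    ∃ f : ℕ → FieldSort M, ultrapower.mk U f = x ∧
      ∀ᶠ n in (U : Filter ℕ), f n ∈ intSubmodule M ⊔ C}
  add_mem' := by
    rintro _ _ ⟨C, hC, f, rfl, hf⟩ ⟨D, hD, g, rfl, hg⟩
    refine ⟨C ⊔ D, hC.sup hD, fun n => f n + g n, (mk_field_add f g).symm, ?_⟩
    filter_upwards [hf, hg] with n hfn hgn
    have h₁ : intSubmodule M ⊔ C ≤ intSubmodule M ⊔ (C ⊔ D) := sup_le_sup_left le_sup_left _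
    have h₂ : intSubmodule M ⊔ D ≤ intSubmodule M ⊔ (C ⊔ D) := sup_le_sup_left le_sup_right _
    exact add_mem (h₁ hfn) (h₂ hgn)
  zero_mem' := ⟨⊥, Submodule.fg_bot, fun _ => 0,
    ((diagonal U M).map_fun VFunc.fieldZero Env.nil).trans
      (congrArg ((M.ultrapower U).funMap VFunc.fieldZero) (Env.nil_eq _)),
    Filter.Eventually.of_forall fun _ => zero_mem _⟩
  smul_mem' := by
    rintro c _ ⟨C, hC, f, rfl, hf⟩
    -- The scalar varies with the index, but one subspace `C` still works because it is stable under
    -- all scalars.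
    obtain ⟨c, rfl⟩ := ultrapower.mk_surjective c
    refine ⟨C, hC, fun n => c n • f n, ?_, ?_⟩
    · rw [smul_eq, mk_liftMap, mk_field_mul]
      rfl
    · filter_upwards [hf] with n hn
      exact Submodule.smul_mem _ _ hn

theorem mem_finiteDimSubmodule_of_isInt [IsModel M] {x : FieldSort (M.ultrapower U)}
    (hx : IsInt x) : x ∈ finiteDimSubmodule M U := by
  obtain ⟨f, rfl⟩ := ultrapower.mk_surjective x
  refine ⟨⊥, Submodule.fg_bot, f, rfl, ?_⟩
  filter_upwards [(mk_isInt f).1 hx] with n hn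
  exact Submodule.mem_sup_left hn

theorem diagonal_mem_finiteDimSubmodule [IsModel M] (x : FieldSort M) :
    (diagonal U M).toFun VSort.field x ∈ finiteDimSubmodule M U :=
  ⟨Submodule.span _ {x}, Submodule.fg_span_singleton x, fun _ => x, rfl,
    Filter.Eventually.of_forall fun _ =>
      Submodule.mem_sup_right (Submodule.mem_span_singleton_self x)⟩

/-- If no `b * a ^ n` is integral, then `res (b / (y - a))` is nonzero for some `y` in the residue
field of some extension. -/
theorem exists_extension [hM : IsModel M] {a b : FieldSort M} (ha : IsInt a)
    (ha' : projMap a = 0) (hb : ∀ n : ℕ, ¬ IsInt (b * a ^ n)) {y : ℕ → ResidueSort M}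
    (hy : Function.Injective y) (hy' : ∀ n, y n ≠ 0) :
    ∃ N : Structure.{u} Lres, N.Models VFresLift ∧ ∃ e : Embedding M N,
      ¬ resVanishes.Realize N (pair (e.toFun VSort.field a) (e.toFun VSort.field b)) := by
  let U : Ultrafilter ℕ := Filter.hyperfilter ℕ
  -- The quotient `b / (y - a)` in the ultrapower, with `y` the class of the sequence of distinct
  -- residues.
  let z : FieldSort (M.ultrapower U) :=
    ultrapower.mk U fun n => b * (liftMap (y n) - a)⁻¹
  have hz : z ∉ finiteDimSubmodule M U := by
    rintro ⟨C, hC, f, hfz, hf⟩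
    -- A single `C` would contain, modulo the valuation ring, almost all of the quotients, but it
    -- contains only finitely many, and the hyperfilter contains all cofinite sets.
    have hfin := finite_div_mem ha ha' hb hy hy' hC
    obtain ⟨n, ⟨h1, h2⟩, h3⟩ :=
      (((ultrapower.mk_eq.1 hfz).and hf).and (hfin.compl_mem_hyperfilter)).exists
    rw [h1] at h2
    exact h3 h2
  obtain ⟨g, hgz, hg⟩ := Submodule.exists_le_ker_of_notMem hz
  -- Add to `res` the multiple of `g` that makes the value at `z` equal to `1`. As `g` kills
  -- `finiteDimSubmodule`, nothing changes on the valuation ring or on the diagonal image of `M`.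
  let f : FieldSort (M.ultrapower U) →ₗ[ResidueSort (M.ultrapower U)]
      ResidueSort (M.ultrapower U) :=
    resHom (M.ultrapower U) + ((1 - resMap z) * (g z)⁻¹) • g
  have hf : ∀ x ∈ finiteDimSubmodule M U, f x = resMap x := by
    intro x hx
    have : g x = 0 := hg hx
    simp [f, this, resHom_apply]
  have hfz : f z = 1 := by
    simp [f, resHom_apply, hgz]
  have hmodel : IsModel (withRes (M.ultrapower U) f) := isModel_withRes f fun x hx =>
    (hf x (mem_finiteDimSubmodule_of_isInt hx)).trans (IsModel.resLaws.res_of_isInt x hx)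
  refine ⟨withRes (M.ultrapower U) f, models_iff.2 hmodel,
    embeddingWithRes (diagonal U M) f fun x =>
      (hf _ (diagonal_mem_finiteDimSubmodule x)).trans (map_resMap _ x).symm, ?_⟩
  rw [realize_resVanishes]
  intro h
  have hy0 : ¬ (ultrapower.mk U y : ResidueSort (M.ultrapower U)) = 0 := by
    intro h0
    rw [← map_residue_zero (diagonal U M)] at h0
    obtain ⟨n, hn⟩ := (ultrapower.mk_eq.1 h0).exists
    exact hy' n hn
  have hzy : z * (liftMap (ultrapower.mk U y : ResidueSort (M.ultrapower U)) +
      -(diagonal U M).toFun VSort.field a) = (diagonal U M).toFun VSort.field b := by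
    change z * (_ + - ultrapower.mk U (fun _ => a)) = ultrapower.mk U (fun _ => b)
    rw [mk_liftMap, mk_field_neg, mk_field_add, mk_field_mul]
    congr 1
    funext n
    rw [← sub_eq_add_neg, mul_assoc, inv_mul_cancel₀ (lift_sub_ne_zero ha ha' (hy' n)), mul_one]
  have h1 : f z = 0 := h (ultrapower.mk U y) z hy0 hzy
  rw [hfz] at h1
  exact one_ne_zero h1

end Extension

end ResidueForm

/-! ### Laurent monomials and the contradiction -/

namespace ResidueForm
open MSLanguage Structure

section Series

variable (F : Type u) [Field F]

/-- The Laurent monomial `t ^ n`. -/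
noncomputable def monomial (n : ℤ) : FieldSort (laurent F) :=
  (HahnSeries.single n (1 : F) : HahnSeries ℤ F)

theorem monomial_mul (m n : ℤ) : monomial F m * monomial F n = monomial F (m + n) := by
  refine (HahnSeries.single_mul_single (Γ := ℤ) (R := F)).trans ?_
  rw [one_mul]
  rfl

theorem isInt_monomial (n : ℤ) : IsInt (monomial F n) ↔ 0 ≤ n := by
  have h : (HahnSeries.single n (1 : F) : HahnSeries ℤ F).orderTop = n :=
    HahnSeries.orderTop_single one_ne_zero
  change (0 : WithTop ℤ) ≤ (HahnSeries.single n (1 : F) : HahnSeries ℤ F).orderTop ↔ _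
  rw [h]
  exact_mod_cast Iff.rfl

theorem res_monomial {n : ℤ} (hn : n ≠ 0) : resMap (monomial F n) = 0 :=
  HahnSeries.coeff_single_of_ne hn.symm

theorem proj_monomial {n : ℤ} (hn : 0 < n) : projMap (monomial F n) = 0 := by
  rw [← laurent_resLaws.res_of_isInt _ ((isInt_monomial F n).2 hn.le)]
  exact res_monomial F hn.ne'

theorem mulPow_monomial (l m : ℤ) (n : ℕ) :
    (mulPow n).realize (laurent F) (pair (monomial F l) (monomial F m)) =
      monomial F (m + l * n) := by
  induction n with
  | zero => simp [mulPow, pair]; rfl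
  | succ n ih =>
    rw [mulPow, realize_field_mul, ih]
    refine (monomial_mul F _ l).trans (congrArg (monomial F) ?_)
    push_cast
    ring

end Series

/-- In every extension of the field of Laurent series, `res (t ^ m / (y - t ^ 2))` vanishes for
odd `m`. -/
theorem resVanishes_of_laurent {F : Type u} [Field F] {N : Structure.{u} Lres} [hN : IsModel N]
    (e : Embedding (laurent F) N) (m : ℕ) :
    resVanishes.Realize N (pair (e.toFun VSort.field (monomial F 2))
      (e.toFun VSort.field (monomial F (-(2 * m + 1))))) := by
  rw [realize_resVanishes]
  intro y z hy hz
  refine res_div_eq_zero ((map_isInt_iff e _).2 ((isInt_monomial F 2).2 zero_le_two)) ?_ (fun n => ?_) ⟨m + 1, ?_⟩ hy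
    ((congrArg (z * ·) (sub_eq_add_neg _ _)).trans hz)
  · rw [← map_projMap, proj_monomial F two_pos, map_residue_zero]
  -- The exponent `-(2 * m + 1) + 2 * n` is odd, hence nonzero.
  · rw [← realize_mulPow, map_mulPow, mulPow_monomial, ← map_resMap, res_monomial F (by lia),
      map_residue_zero]
  -- For `n = m + 1` the exponent is `1`.
  · rw [← realize_mulPow, map_mulPow, mulPow_monomial, map_isInt_iff, isInt_monomial]
    push_cast
    lia

end ResidueForm

open MSLanguage Structure ResidueForm in
/-- The theory of equal characteristic valued fields with a lift of the residue field and a total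
residue map has no model companion. (The universe `u` of the models is arbitrary.) -/
theorem mainTheorem1 :
    ¬ ∃ T : MSLanguage.Theory ResidueForm.Lres,
      MSLanguage.Theory.IsModelCompanion.{u} ResidueForm.VFresLift T := by
  rintro ⟨T, hT⟩
  -- What matters about `ℚ` is that it is infinite; `ULift` moves it to the universe of the models.
  let F : Type u := ULift.{u} ℚ
  obtain ⟨N, hN, ⟨e⟩⟩ := hT.embeds_left (laurent F) (models_iff.2 inferInstance)
  obtain ⟨N', hN', ⟨e'⟩⟩ := hT.embeds_right N hN
  have hN'' : IsModel N' := models_iff.1 hN'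
  let a : FieldSort N := e.toFun VSort.field (monomial F 2)
  let b : ℕ → FieldSort N := fun m => e.toFun VSort.field (monomial F (-(2 * m + 1)))
  -- `N` need not be a model of `VFresLift`, but it embeds into one, and a universal formula
  -- descends to `N`.
  have hab : ∀ m, resVanishes.Realize N (pair a (b m)) := fun m =>
    resVanishes_of_embedding e' (resVanishes_of_laurent (e'.comp e) m)
  let U : Ultrafilter ℕ := Filter.hyperfilter ℕ
  let M := N.ultrapower U
  have hM : M.Models T := Structure.Models.ultrapower hN
  let aM : FieldSort M := ultrapower.mk U fun _ => a
  let bM : FieldSort M := ultrapower.mk U b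
  have hvan : resVanishes.Realize M (pair aM bM) :=
    (ultrapower_realize_pair _ _ _).2 (Filter.Eventually.of_forall hab)
  have h_int : ∀ n : ℕ, ¬ IsInt (M := M) ((mulPow n).realize M (pair aM bM)) := by
    intro n
    have h := ultrapower_realize_term_pair (U := U) (mulPow n) (fun _ => a) b
    rw [show (mulPow n).realize M (pair aM bM) = _ from h, mk_isInt,
      ← Ultrafilter.eventually_not]
    -- For `m ≥ n` the exponent `-(2 * m + 1) + 2 * n` is negative.
    have hn : ∀ᶠ m : ℕ in (U : Filter ℕ), n ≤ m :=
      (Filter.eventually_ge_atTop n).filter_mono Nat.hyperfilter_le_atTop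
    filter_upwards [hn] with m hm
    rw [map_mulPow, mulPow_monomial, map_isInt_iff, isInt_monomial]
    lia
  obtain ⟨M', hM', ⟨f⟩⟩ := hT.embeds_right M hM
  have hM'' : IsModel M' := models_iff.1 hM'
  let E : Embedding (laurent F) M' := f.comp ((diagonal U N).comp e)
  -- The shift by `1` avoids the residue `0`.
  let y : ℕ → ResidueSort M' := fun n => E.toFun VSort.residue (ULift.up ((n : ℚ) + 1) : F)
  have hy : Function.Injective y := by
    intro n n' h
    have := congrArg ULift.down (E.injective _ h)
    exact_mod_cast add_right_cancel this
  have hy' : ∀ n, y n ≠ 0 := by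
    intro n h
    rw [← map_residue_zero E] at h
    have := congrArg ULift.down (E.injective _ h)
    exact absurd this (Nat.cast_add_one_ne_zero n)
  obtain ⟨P, hP, g, hg⟩ := exists_extension (M := M') (a := f.toFun VSort.field aM)
    (b := f.toFun VSort.field bM) ((map_isInt_iff E _).2 ((isInt_monomial F 2).2 zero_le_two))
    ((map_projMap E _).symm.trans ((congrArg _ (proj_monomial F two_pos)).trans (map_residue_zero E)))
    (fun n => by rw [← realize_mulPow, map_mulPow, map_isInt_iff]; exact h_int n) hy hy'
  obtain ⟨Q, hQ, ⟨h⟩⟩ := hT.embeds_left P hP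
  refine hg (resVanishes_of_embedding h ?_)
  -- Model-completeness carries the formula from `M` up to `Q`; being universal, it would then hold
  -- in `P`, where it fails.
  have hel := (hT.modelComplete M Q hM hQ (h.comp (g.comp f)) _ resVanishes (pair aM bM)).1 hvan
  rwa [pair_map] at hel
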